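/- Let $n\ge 0$, let $a_1,\dots,a_n$ be positive integers and $N=a_1+\dots+a_n$, and write $x=(x_1,\dots,x_n)\in\mathbb R^N=\mathbb R^{a_1}\oplus\cdots\oplus\mathbb R^{a_n}$ with $x_k\in\mathbb R^{a_k}$; let $|x_k|$ be the Euclidean norm of $x_k$. Let $1\le d_1\le d_2\le\cdots\le d_n$ be integers (for instance $d_k=k$). Let $G$ be a homogeneous nilpotent Lie group with underlying manifold $\mathbb R^N$, i.e. $\mathbb R^N$ with a smooth group law $(x,y)\mapsto xy$ (and smooth inversion) for which the dilations $\delta_r(x)=(r^{d_1}x_1,\dots,r^{d_n}x_n)$, $r>0$, are automorphisms. (Nilpotency then holds automatically.) Let $m$ (or $dy$) be Lebesgue measure on $\mathbb R^N$, and $L^p(G)=L^p(\mathbb R^N,m)$. For $s=(s_1,\dots,s_n)$ with all $s_k>0$ put $$R_s=\{x\in\mathbb R^N:\ |x_k|\le s_k^{d_k}\ \text{ for } k=1,\dots,n\},$$ and call $s$ acceptable if $s_1\le s_2\le\cdots\le s_n$. For a measurable scalar-valued (real or complex) function $f$ on $G$ define $$M(f)(x)=\sup_{s\ \text{acceptable}}\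 \frac1{m(R_s)}\int_{R_s}|f(x\,y^{-1})|\,dy\ \in[0,\infty],\qquad x\in G .$$ Then for every $1<p<\infty$: (a) $M$ is a bounded map of $L^p(G)$ to itself: if $f=g$ almost everywhere then $M(f)=M(g)$, and there is a finite constant $A$, depending only on $p$ and $G$ (with its dilations and decomposition into blocks), such that for every $f\in L^p(G)$ the function $M(f)$ is measurable, belongs to $L^p(G)$, and satisfies $\|M(f)\|_{L^p(G)}\le A\,\|f\|_{L^p(G)}$. (b) There is a finite constant $A_p$, depending only on $p$ and $G$ (with its dilations and decomposition into blocks), such that for every sequence $(f_j)_{j\in\mathbb N}$ of measurable scalar-valued functions on $G$ $$\Big\|\Big(\sum_j M(f_j)^2\Big)^{1/2}\Big\|_{L^p(G)}\ \le\ A_p\,\Big\|\Big(\sum_j|f_j|^2\Big)^{1/2}\Big\|_{L^p(G)} ,$$ where both sides are allowed to be $+\infty$. -/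

import Mathlib

open MeasureTheory
open scoped ENNReal NNReal

/-- The space `ℝ^N = ℝ^{a_1} ⊕ ⋯ ⊕ ℝ^{a_n}`; a point is `x = (x_1, …, x_n)` with
`x_k ∈ ℝ^{a_k}`, and each block carries its Euclidean norm. The topology, smooth structure and
Lebesgue measure (`volume`) are the usual ones of `ℝ^N`. -/
abbrev BlockSpace {n : ℕ} (a : Fin n → ℕ) : Type :=
  (k : Fin n) → EuclideanSpace ℝ (Fin (a k))

/-- The dilation `δ_r (x_1, …, x_n) = (r^{d_1} x_1, …, r^{d_n} x_n)`. -/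
def blockDilation {n : ℕ} {a : Fin n → ℕ} (d : Fin n → ℕ) (r : ℝ) (x : BlockSpace a) :
    BlockSpace a :=
  fun k => r ^ d k • x k

/-- A homogeneous (Lie) group on `ℝ^N = ℝ^{a_1} ⊕ ⋯ ⊕ ℝ^{a_n}`: a smooth group law, written
multiplicatively, for which the dilations `δ_r`, `r > 0`, are automorphisms. When all exponents
are positive the law is automatically polynomial and nilpotent, with neutral element `0`. -/
structure HomogeneousGroup {n : ℕ} (a d : Fin n → ℕ) extends Group (BlockSpace a) where
  contDiff_mul : ContDiff ℝ ((⊤ : ℕ∞) : WithTop ℕ∞)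
    (fun z : BlockSpace a × BlockSpace a => z.1 * z.2)
  contDiff_inv : ContDiff ℝ ((⊤ : ℕ∞) : WithTop ℕ∞) (fun z : BlockSpace a => z⁻¹)
  dilation_mul : ∀ r : ℝ, 0 < r → ∀ x y : BlockSpace a,
    blockDilation d r (x * y) = blockDilation d r x * blockDilation d r y

/-- The rectangle `R_s = {x : |x_k| ≤ s_k^{d_k} for all k}`. -/
def blockRectangle {n : ℕ} (a d : Fin n → ℕ) (s : Fin n → ℝ) : Set (BlockSpace a) :=
  {x | ∀ k, ‖x k‖ ≤ s k ^ d k}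

/-- The size `s = (s_1, …, s_n)` is acceptable: `0 < s_1 ≤ s_2 ≤ ⋯ ≤ s_n`. -/
def IsAcceptable {n : ℕ} (s : Fin n → ℝ) : Prop :=
  (∀ k, 0 < s k) ∧ Monotone s

/-- The maximal function
`M f (x) = sup_s m(R_s)⁻¹ ∫_{R_s} |f (x y⁻¹)| dy`, the supremum being over all acceptable `s`;
it takes values in `[0, ∞]`. -/
noncomputable def HomogeneousGroup.maximalFunction {n : ℕ} {a d : Fin n → ℕ}
    (G : HomogeneousGroup a d) {𝕜 : Type*} [RCLike 𝕜] (f : BlockSpace a → 𝕜)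
    (x : BlockSpace a) : ℝ≥0∞ :=
  letI : Group (BlockSpace a) := G.toGroup
  ⨆ (s : Fin n → ℝ) (_ : IsAcceptable s),
    (volume (blockRectangle a d s))⁻¹ * ∫⁻ y in blockRectangle a d s, ‖f (x * y⁻¹)‖ₑ

/-!
The derivative of the group law commutes with the dilations, and letting `δ_r → δ_0` shows that the
`k`-th block of a product depends only on the first `k` blocks of the factors. With compactness of
the unit ball this makes products and inverses of points of a rectangle of acceptable size lie in a
fixed multiple of the rectangle. Another consequence is that the average over a rectangle is
dominated by a composition of averages over rectangles with sizes `(m, …, m, t, …, t)`. For fixed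
`m` and varying `t` these form a nested family, to which Vitali's covering lemma applies and gives
`t ∫_{Mf > t} w ≤ K ∫ f M'w` for the maximal operator `M'` of a slightly enlarged family.
Marcinkiewicz interpolation gives the weighted `L^q` inequality, whence the vector-valued bound at
`p = 2`; duality with the weight gives `p > 2`, and for `p < 2` one factors `f_j ≤ g_j^{1-θ} h^θ`,
with `h` a power of the square function, and uses `M(g^{1-θ} h^θ) ≤ (Mg)^{1-θ} (Mh)^θ` and Hölder's
inequality.

All constants are independent of `m`, so `m → 0` is harmless. Finally, rectangles are compared
with those whose sizes are powers of `ρ`: `ρ = 2` suffices for the bounds, and `ρ → 1` exhibits the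
maximal function as a countable infimum of measurable functions.
-/

section OperatorBounds

variable {α : Type*} [MeasurableSpace α] {μ : Measure α} {p : ℝ}
  {T N : (α → ℝ≥0∞) → α → ℝ≥0∞}

/-- The operator `T` on nonnegative functions is of strong type `(p, p)`, with constant `C` for
the `p`-th powers of the norms. -/
def StrongTypeBound (μ : Measure α) (p : ℝ) (C : ℝ≥0) (T : (α → ℝ≥0∞) → α → ℝ≥0∞) : Prop :=
  ∀ f, Measurable f → ∫⁻ x, T f x ^ p ∂μ ≤ C * ∫⁻ x, f x ^ p ∂μ

/-- The operator `T`, applied termwise to sequences of nonnegative functions, is bounded on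
`L^p(ℓ²)`, with constant `C` for the `p`-th powers of the norms. -/
def SquareFunctionBound (μ : Measure α) (p : ℝ) (C : ℝ≥0) (T : (α → ℝ≥0∞) → α → ℝ≥0∞) : Prop :=
  ∀ f : ℕ → α → ℝ≥0∞, (∀ j, Measurable (f j)) →
    ∫⁻ x, (∑' j, T (f j) x ^ 2) ^ (p / 2) ∂μ ≤ C * ∫⁻ x, (∑' j, f j x ^ 2) ^ (p / 2) ∂μ

theorem StrongTypeBound.lintegral_tsum_rpow_le {C : ℝ≥0} (h : StrongTypeBound μ p C T)
    (hT : ∀ f, Measurable f → Measurable (T f)) {f : ℕ → α → ℝ≥0∞} (hf : ∀ j, Measurable (f j)) :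
    ∫⁻ x, ∑' j, T (f j) x ^ p ∂μ ≤ C * ∫⁻ x, ∑' j, f j x ^ p ∂μ := by
  rw [lintegral_tsum fun j => ((hT _ (hf j)).pow_const p).aemeasurable,
    lintegral_tsum fun j => ((hf j).pow_const p).aemeasurable, ← ENNReal.tsum_mul_left]
  exact ENNReal.tsum_le_tsum fun j => h _ (hf j)

namespace SquareFunctionBound

theorem comp {C₁ C₂ : ℝ≥0} {T₁ T₂ : (α → ℝ≥0∞) → α → ℝ≥0∞} (h₁ : SquareFunctionBound μ p C₁ T₁)
    (h₂ : SquareFunctionBound μ p C₂ T₂) (hT₂ : ∀ f, Measurable f → Measurable (T₂ f)) :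
    SquareFunctionBound μ p (C₁ * C₂) (T₁ ∘ T₂) := fun f hf =>
  calc ∫⁻ x, (∑' j, T₁ (T₂ (f j)) x ^ 2) ^ (p / 2) ∂μ
      ≤ C₁ * ∫⁻ x, (∑' j, T₂ (f j) x ^ 2) ^ (p / 2) ∂μ := h₁ _ fun j => hT₂ _ (hf j)
    _ ≤ C₁ * (C₂ * ∫⁻ x, (∑' j, f j x ^ 2) ^ (p / 2) ∂μ) := by gcongr; exact h₂ f hf
    _ = (C₁ * C₂ : ℝ≥0) * ∫⁻ x, (∑' j, f j x ^ 2) ^ (p / 2) ∂μ := by push_cast; ring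

theorem of_le_mul (hp : 0 ≤ p) {A C : ℝ≥0} (hN : SquareFunctionBound μ p C N)
    (hTN : ∀ f, Measurable f → ∀ x, T f x ≤ A * N f x) :
    SquareFunctionBound μ p (A ^ p * C) T := by
  intro f hf
  have hpointwise : ∀ x, (∑' j, T (f j) x ^ 2) ^ (p / 2) ≤
      (A : ℝ≥0∞) ^ p * (∑' j, N (f j) x ^ 2) ^ (p / 2) := fun x => by
    calc (∑' j, T (f j) x ^ 2) ^ (p / 2) ≤ (∑' j, (A * N (f j) x) ^ 2) ^ (p / 2) := by
          gcongr with j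
          exact hTN _ (hf j) x
      _ = (A : ℝ≥0∞) ^ p * (∑' j, N (f j) x ^ 2) ^ (p / 2) := by
          simp_rw [mul_pow]
          rw [ENNReal.tsum_mul_left, ENNReal.mul_rpow_of_nonneg _ _ (by positivity),
            ← ENNReal.rpow_natCast_mul]
          congr 2
          push_cast
          ring
  calc ∫⁻ x, (∑' j, T (f j) x ^ 2) ^ (p / 2) ∂μ
      ≤ ∫⁻ x, (A : ℝ≥0∞) ^ p * (∑' j, N (f j) x ^ 2) ^ (p / 2) ∂μ := lintegral_mono hpointwise
    _ = (A : ℝ≥0∞) ^ p * ∫⁻ x, (∑' j, N (f j) x ^ 2) ^ (p / 2) ∂μ :=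
        lintegral_const_mul' _ _ (by finiteness)
    _ ≤ (A : ℝ≥0∞) ^ p * (C * ∫⁻ x, (∑' j, f j x ^ 2) ^ (p / 2) ∂μ) := by gcongr; exact hN f hf
    _ = (A ^ p * C : ℝ≥0) * ∫⁻ x, (∑' j, f j x ^ 2) ^ (p / 2) ∂μ := by
        rw [ENNReal.coe_mul, ENNReal.coe_rpow_of_nonneg _ hp, mul_assoc]

theorem iSup (hp : 0 < p) {C : ℝ≥0} {T : ℕ → (α → ℝ≥0∞) → α → ℝ≥0∞} (hmono : Monotone T)
    (hmeas : ∀ m f, Measurable f → Measurable (T m f))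
    (hT : ∀ m, SquareFunctionBound μ p C (T m)) :
    SquareFunctionBound μ p C (fun f x => ⨆ m, T m f x) := by
  intro f hf
  have hmono' : ∀ x, Monotone fun m => ∑' j, T m (f j) x ^ 2 := fun x m m' hm =>
    ENNReal.tsum_le_tsum fun j => by gcongr; exact hmono hm _ _
  have hpow : ∀ x, (∑' j, (⨆ m, T m (f j) x) ^ 2) ^ (p / 2) =
      ⨆ m, (∑' j, T m (f j) x ^ 2) ^ (p / 2) := fun x => by
    have hsq : ∀ j, (⨆ m, T m (f j) x) ^ 2 = ⨆ m, T m (f j) x ^ 2 := fun j =>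
      ENNReal.iSup_pow_of_ne_zero two_ne_zero _
    have htsum : ∑' j, ⨆ m, T m (f j) x ^ 2 = ⨆ m, ∑' j, T m (f j) x ^ 2 := by
      simp_rw [← lintegral_count]
      exact lintegral_iSup (fun _ => measurable_from_nat) fun m m' hm j => by
        gcongr
        exact hmono hm _ _
    simp_rw [hsq, htsum]
    exact (ENNReal.orderIsoRpow (p / 2) (by positivity)).map_iSup _
  simp_rw [hpow]
  rw [lintegral_iSup (fun m => (Measurable.tsum fun j =>
    (hmeas m _ (hf j)).pow_const 2).pow_const _) fun m m' hm x => by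
      exact ENNReal.rpow_le_rpow (hmono' x hm) (by positivity)]
  exact iSup_le fun m => hT m f hf

theorem of_strongTypeBound_two {C : ℝ≥0} (hT : ∀ f, Measurable f → Measurable (T f))
    (h : StrongTypeBound μ 2 C T) : SquareFunctionBound μ 2 C T := fun f hf => by
  simpa only [div_self (two_ne_zero' ℝ), ENNReal.rpow_one, ENNReal.rpow_two] using
    h.lintegral_tsum_rpow_le hT hf

end SquareFunctionBound

theorem lintegral_rpow_le_of_forall_le [SigmaFinite μ] {F : α → ℝ≥0∞} {q : ℝ} (hq : 0 < q)
    {C : ℝ≥0∞} (h : ∀ v : α → ℝ≥0∞, Measurable v → v ≤ F → ∫⁻ x, v x ^ q ∂μ ≠ ∞ →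
      ∫⁻ x, v x ^ q ∂μ ≤ C) : ∫⁻ x, F x ^ q ∂μ ≤ C := by
  refine le_of_forall_lt fun L hL => ?_
  rw [lintegral_eq_nnreal] at hL
  obtain ⟨φ, hφF, hLφ⟩ := lt_biSup_iff.mp hL
  rw [← SimpleFunc.lintegral_eq_lintegral] at hLφ
  obtain ⟨ψ, hψφ, hψ, hLψ⟩ := SimpleFunc.exists_lt_lintegral_simpleFunc_of_lt_lintegral hLφ
  have hψq : ∀ x, ((ψ x : ℝ≥0∞) ^ (1 / q)) ^ q = ψ x := fun x => by
    rw [← ENNReal.rpow_mul, one_div_mul_cancel hq.ne', ENNReal.rpow_one]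
  have hbound := h (fun x => (ψ x : ℝ≥0∞) ^ (1 / q)) (by fun_prop)
    (fun x => by
      rw [one_div, ENNReal.rpow_inv_le_iff hq]
      exact (ENNReal.coe_le_coe.mpr (hψφ x)).trans (hφF x))
  simp only [hψq] at hbound
  exact hLψ.trans_le (hbound hψ.ne)

theorem le_rpow_of_le_mul_rpow {x a : ℝ≥0∞} (hx : x ≠ ∞) {q q' : ℝ} (hq : q.HolderConjugate q')
    (h : x ≤ a * x ^ (1 / q')) : x ≤ a ^ q := by
  rcases eq_or_ne x 0 with rfl | h0
  · exact zero_le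
  have hpos : x ^ (1 / q') ≠ 0 := (ENNReal.rpow_pos (pos_iff_ne_zero.mpr h0) hx).ne'
  have htop : x ^ (1 / q') ≠ ∞ := ENNReal.rpow_ne_top_of_nonneg' (pos_iff_ne_zero.mpr h0) hx
  rw [← ENNReal.rpow_inv_le_iff hq.pos, ← ENNReal.mul_le_mul_iff_left hpos htop,
    ← ENNReal.rpow_add _ _ h0 hx, one_div, hq.inv_add_inv_eq_one, ENNReal.rpow_one, ← one_div]
  exact h

theorem lintegral_tsum_sq_mul_le {A : ℝ≥0} (hT : ∀ f, Measurable f → Measurable (T f))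
    {w w' : α → ℝ≥0∞} (hw : Measurable w) (hw' : Measurable w')
    (h : ∀ f, Measurable f → ∫⁻ x, T f x ^ 2 * w x ∂μ ≤ A * ∫⁻ x, f x ^ 2 * w' x ∂μ)
    {f : ℕ → α → ℝ≥0∞} (hf : ∀ j, Measurable (f j)) :
    ∫⁻ x, (∑' j, T (f j) x ^ 2) * w x ∂μ ≤ A * ∫⁻ x, (∑' j, f j x ^ 2) * w' x ∂μ := by
  have hTf : ∀ j, Measurable (T (f j)) := fun j => hT _ (hf j)
  simp_rw [← ENNReal.tsum_mul_right]
  rw [lintegral_tsum fun j => by fun_prop, lintegral_tsum fun j => by fun_prop,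
    ← ENNReal.tsum_mul_left]
  exact ENNReal.tsum_le_tsum fun j => h _ (hf j)

/- Duality between `L^q` and `L^{q'}`, the dual function being the power `v^{q-1}` of a minorant
`v` of the square function whose norm is finite, so that it can be cancelled. -/
theorem SquareFunctionBound.of_weighted [SigmaFinite μ] {q q' : ℝ} (hq : q.HolderConjugate q')
    {A C : ℝ≥0} (hT : ∀ f, Measurable f → Measurable (T f))
    (hN : ∀ f, Measurable f → Measurable (N f))
    (hTN : ∀ f w, Measurable f → Measurable w →
      ∫⁻ x, T f x ^ 2 * w x ∂μ ≤ A * ∫⁻ x, f x ^ 2 * N w x ∂μ)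
    (hNC : StrongTypeBound μ q' C N) :
    SquareFunctionBound μ (2 * q) ((A * C ^ (1 / q')) ^ q) T := by
  intro f hf
  rw [mul_div_cancel_left₀ q two_ne_zero]
  set S : α → ℝ≥0∞ := fun x => ∑' j, f j x ^ 2
  have hSm : Measurable S := by fun_prop
  refine lintegral_rpow_le_of_forall_le hq.pos fun v hv hvT hfin => ?_
  set w : α → ℝ≥0∞ := fun x => v x ^ (q - 1)
  have hwm : Measurable w := by fun_prop
  have hvw : ∀ x, v x ^ q = v x * w x := fun x => by
    conv_rhs => rw [← ENNReal.rpow_one (v x)]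
    rw [← ENNReal.rpow_add_of_nonneg _ _ zero_le_one hq.sub_one_pos.le, add_sub_cancel]
  have hwq : ∀ x, w x ^ q' = v x ^ q := fun x => by
    rw [← ENNReal.rpow_mul, hq.sub_one_mul_conj]
  have hself : ∫⁻ x, v x ^ q ∂μ ≤ ((A * C ^ (1 / q') : ℝ≥0) * (∫⁻ x, S x ^ q ∂μ) ^ (1 / q)) *
      (∫⁻ x, v x ^ q ∂μ) ^ (1 / q') :=
    calc ∫⁻ x, v x ^ q ∂μ ≤ ∫⁻ x, (∑' j, T (f j) x ^ 2) * w x ∂μ := by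
          simp_rw [hvw]
          gcongr with x
          exact hvT x
      _ ≤ A * ∫⁻ x, S x * N w x ∂μ :=
          lintegral_tsum_sq_mul_le hT hwm (hN w hwm) (fun g hg => hTN g w hg hwm) hf
      _ ≤ A * ((∫⁻ x, S x ^ q ∂μ) ^ (1 / q) * (∫⁻ x, N w x ^ q' ∂μ) ^ (1 / q')) := by
          gcongr
          exact ENNReal.lintegral_mul_le_Lp_mul_Lq μ hq hSm.aemeasurable (hN w hwm).aemeasurable
      _ ≤ A * ((∫⁻ x, S x ^ q ∂μ) ^ (1 / q) * (C * ∫⁻ x, v x ^ q ∂μ) ^ (1 / q')) := by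
          have hq' := hq.symm.nonneg
          gcongr
          exact (hNC w hwm).trans_eq (by simp_rw [hwq])
      _ = _ := by
          rw [ENNReal.mul_rpow_of_nonneg _ _ hq.symm.one_div_nonneg, ENNReal.coe_mul,
            ENNReal.coe_rpow_of_nonneg _ hq.symm.one_div_nonneg]
          ring
  refine (le_rpow_of_le_mul_rpow hfin hq hself).trans_eq ?_
  rw [ENNReal.mul_rpow_of_nonneg _ _ hq.nonneg, ← ENNReal.rpow_mul,
    one_div_mul_cancel hq.ne_zero, ENNReal.rpow_one, ENNReal.coe_rpow_of_nonneg _ hq.nonneg]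

theorem exists_measurable_le_mul_rpow_tsum_sq {f : ℕ → α → ℝ≥0∞} (hf : ∀ j, Measurable (f j))
    {σ : ℝ} (hσ0 : 0 < σ) (hσ1 : σ < 1) :
    ∃ g : ℕ → α → ℝ≥0∞, (∀ j, Measurable (g j)) ∧
      (∀ j x, f j x ≤ g j x * (∑' i, f i x ^ 2) ^ (σ / 2)) ∧
      ∀ x, ∑' j, g j x ^ 2 ≤ (∑' j, f j x ^ 2) ^ (1 - σ) := by
  set S : α → ℝ≥0∞ := fun x => ∑' j, f j x ^ 2
  have hSm : Measurable S := by fun_prop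
  have hf0 : ∀ x, S x = 0 → ∀ j, f j x = 0 := fun x hx j => by
    simpa using ENNReal.tsum_eq_zero.mp hx j
  refine ⟨fun j x => if S x = ∞ then ∞ else f j x * S x ^ (-(σ / 2)), fun j =>
    Measurable.ite (hSm (measurableSet_singleton ∞)) measurable_const (by fun_prop),
    fun j x => ?_, fun x => ?_⟩
  · change _ ≤ _ * S x ^ (σ / 2)
    by_cases htop : S x = ∞
    · simp [htop, ENNReal.top_rpow_of_pos (half_pos hσ0)]
    by_cases hzero : S x = 0
    · simp [hf0 x hzero]
    simp [htop, mul_assoc, ← ENNReal.rpow_add _ _ hzero htop]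
  · change _ ≤ S x ^ (1 - σ)
    by_cases htop : S x = ∞
    · simp [htop, ENNReal.top_rpow_of_pos (sub_pos.mpr hσ1)]
    by_cases hzero : S x = 0
    · simp [hf0 x hzero, htop]
    have hsq : (S x ^ (-(σ / 2))) ^ 2 = S x ^ (-σ) := by
      rw [← ENNReal.rpow_mul_natCast]
      congr 1
      push_cast
      ring
    simp only [htop, if_false, mul_pow, hsq]
    rw [ENNReal.tsum_mul_right, sub_eq_add_neg, ENNReal.rpow_add _ _ hzero htop, ENNReal.rpow_one]

theorem exists_measurable_le_rpow_mul_rpow {f : ℕ → α → ℝ≥0∞} (hf : ∀ j, Measurable (f j)) {θ : ℝ}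
    (hp0 : 0 < p) (hp2 : p < 2) (hθ0 : 0 < θ) (hθ1 : θ < 1) :
    ∃ (g : ℕ → α → ℝ≥0∞) (h : α → ℝ≥0∞), (∀ j, Measurable (g j)) ∧ Measurable h ∧
      (∀ j, f j ≤ fun x => g j x ^ (1 - θ) * h x ^ θ) ∧
      (∀ x, ∑' j, g j x ^ (2 * (1 - θ)) ≤ (∑' j, f j x ^ 2) ^ (p / 2)) ∧
      ∀ x, h x ^ (θ * p / (1 - p / 2)) = (∑' j, f j x ^ 2) ^ (p / 2) := by
  obtain ⟨G, hGm, hfG, hGS⟩ :=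
    exists_measurable_le_mul_rpow_tsum_sq hf (σ := 1 - p / 2) (by linarith) (by linarith)
  have hG : ∀ j x, (G j x ^ (1 / (1 - θ))) ^ (1 - θ) = G j x := fun j x => by
    rw [← ENNReal.rpow_mul, one_div_mul_cancel (by linarith), ENNReal.rpow_one]
  refine ⟨fun j x => G j x ^ (1 / (1 - θ)),
    fun x => (∑' j, f j x ^ 2) ^ ((1 - p / 2) / (2 * θ)), by fun_prop, by fun_prop,
    fun j x => ?_, fun x => ?_, fun x => ?_⟩
  · have hexp : (1 - p / 2) / (2 * θ) * θ = (1 - p / 2) / 2 := by field_simp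
    change _ ≤ (G j x ^ (1 / (1 - θ))) ^ (1 - θ) * _
    rw [hG, ← ENNReal.rpow_mul, hexp]
    exact hfG j x
  · simp_rw [mul_comm (2 : ℝ), ENNReal.rpow_mul, hG, ENNReal.rpow_two]
    simpa using hGS x
  · have := (sub_pos.mpr hp2).ne'
    rw [← ENNReal.rpow_mul]
    congr 1
    field_simp

theorem tsum_sq_rpow_le_of_le_rpow_mul {θ : ℝ} (hp : 0 ≤ p) {u a : ℕ → ℝ≥0∞} {b : ℝ≥0∞}
    (h : ∀ j, u j ≤ a j ^ (1 - θ) * b ^ θ) :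
    (∑' j, u j ^ 2) ^ (p / 2) ≤ (∑' j, a j ^ (2 * (1 - θ))) ^ (p / 2) * b ^ (θ * p) := by
  have hsq : ∀ j, u j ^ 2 ≤ a j ^ (2 * (1 - θ)) * b ^ (2 * θ) := fun j => by
    calc u j ^ 2 ≤ (a j ^ (1 - θ) * b ^ θ) ^ 2 := by gcongr; exact h j
      _ = a j ^ (2 * (1 - θ)) * b ^ (2 * θ) := by
          rw [mul_pow, ← ENNReal.rpow_mul_natCast, ← ENNReal.rpow_mul_natCast]
          push_cast
          rw [mul_comm (1 - θ), mul_comm θ]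
  calc (∑' j, u j ^ 2) ^ (p / 2)
      ≤ (∑' j, a j ^ (2 * (1 - θ)) * b ^ (2 * θ)) ^ (p / 2) := by gcongr with j; exact hsq j
    _ = (∑' j, a j ^ (2 * (1 - θ))) ^ (p / 2) * b ^ (θ * p) := by
        rw [ENNReal.tsum_mul_right, ENNReal.mul_rpow_of_nonneg _ _ (by positivity),
          ← ENNReal.rpow_mul]
        congr 2
        ring

/- Writing `f_j ≤ g_j^{1-θ} h^θ` with `∑ g_j^{2(1-θ)}` and `h` powers of the square function of the
sequence reduces the vector-valued bound to two scalar ones. -/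
theorem SquareFunctionBound.of_strongTypeBound {θ : ℝ} (hp0 : 0 < p) (hp2 : p < 2) (hθ0 : 0 < θ)
    (hθ1 : θ < 1) {C₁ C₂ : ℝ≥0} (hT : ∀ f, Measurable f → Measurable (T f)) (hmono : Monotone T)
    (hgeom : ∀ f g, Measurable f → Measurable g → ∀ x,
      T (fun y => f y ^ (1 - θ) * g y ^ θ) x ≤ T f x ^ (1 - θ) * T g x ^ θ)
    (h₁ : StrongTypeBound μ (2 * (1 - θ)) C₁ T)
    (h₂ : StrongTypeBound μ (θ * p / (1 - p / 2)) C₂ T) :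
    SquareFunctionBound μ p (C₁ ^ (p / 2) * C₂ ^ (1 - p / 2)) T := by
  intro f hf
  have hp20 : 0 < p / 2 := by positivity
  have hσ0 : 0 < 1 - p / 2 := by linarith
  set r := θ * p / (1 - p / 2) with hr
  set S : α → ℝ≥0∞ := fun x => ∑' j, f j x ^ 2
  obtain ⟨g, h, hgm, hhm, hfgh, hgS, hhS⟩ :=
    exists_measurable_le_rpow_mul_rpow hf hp0 hp2 hθ0 hθ1
  have hTgm : Measurable fun x => ∑' j, T (g j) x ^ (2 * (1 - θ)) :=
    .tsum fun j => (hT _ (hgm j)).pow_const _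
  have hsum : ∫⁻ x, ∑' j, T (g j) x ^ (2 * (1 - θ)) ∂μ ≤ C₁ * ∫⁻ x, S x ^ (p / 2) ∂μ := by
    refine (h₁.lintegral_tsum_rpow_le hT hgm).trans ?_
    gcongr with x
    exact hgS x
  have hsingle : ∫⁻ x, T h x ^ r ∂μ ≤ C₂ * ∫⁻ x, S x ^ (p / 2) ∂μ := by
    simpa only [r, S, hhS] using h₂ h hhm
  calc ∫⁻ x, (∑' j, T (f j) x ^ 2) ^ (p / 2) ∂μ
      ≤ ∫⁻ x, (∑' j, T (g j) x ^ (2 * (1 - θ))) ^ (p / 2) * (T h x ^ r) ^ (1 - p / 2) ∂μ := by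
        refine lintegral_mono fun x => ?_
        rw [← ENNReal.rpow_mul, hr, div_mul_cancel₀ _ hσ0.ne']
        exact tsum_sq_rpow_le_of_le_rpow_mul hp0.le fun j => (hmono (hfgh j) x).trans
          (hgeom _ _ (hgm j) hhm x)
    _ ≤ (∫⁻ x, ∑' j, T (g j) x ^ (2 * (1 - θ)) ∂μ) ^ (p / 2) *
        (∫⁻ x, T h x ^ r ∂μ) ^ (1 - p / 2) :=
        ENNReal.lintegral_mul_norm_pow_le hTgm.aemeasurable ((hT h hhm).pow_const r).aemeasurable
          hp20.le hσ0.le (add_sub_cancel _ _)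
    _ ≤ (C₁ * ∫⁻ x, S x ^ (p / 2) ∂μ) ^ (p / 2) *
        (C₂ * ∫⁻ x, S x ^ (p / 2) ∂μ) ^ (1 - p / 2) := by gcongr
    _ = (C₁ ^ (p / 2) * C₂ ^ (1 - p / 2) : ℝ≥0) * ∫⁻ x, S x ^ (p / 2) ∂μ := by
        rw [ENNReal.mul_rpow_of_nonneg _ _ hp20.le, ENNReal.mul_rpow_of_nonneg _ _ hσ0.le,
          mul_mul_mul_comm, ← ENNReal.rpow_add_of_nonneg _ _ hp20.le hσ0.le, add_sub_cancel,
          ENNReal.rpow_one, ENNReal.coe_mul, ENNReal.coe_rpow_of_nonneg _ hp20.le,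
          ENNReal.coe_rpow_of_nonneg _ hσ0.le]

end OperatorBounds

section LayerCake

theorem setLIntegral_Ioi_ofReal_rpow_eq_top (s : ℝ) :
    ∫⁻ t in Set.Ioi (0 : ℝ), ENNReal.ofReal (t ^ s) = ∞ := by
  by_contra hfin
  refine not_integrableOn_Ioi_rpow s ⟨by fun_prop, ?_⟩
  rw [hasFiniteIntegral_iff_ofReal]
  · exact lt_top_iff_ne_top.mpr hfin
  · exact (ae_restrict_mem measurableSet_Ioi).mono fun t ht => Real.rpow_nonneg (le_of_lt ht) s

variable {α β : Type*} [MeasurableSpace α] [MeasurableSpace β]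

theorem lintegral_rpow_eq_lintegral_measure_ofReal_lt (ν : Measure α) {g : α → ℝ≥0∞}
    (hg : Measurable g) {s : ℝ} (hs : 0 < s) :
    ∫⁻ x, g x ^ s ∂ν = ENNReal.ofReal s *
      ∫⁻ t in Set.Ioi (0 : ℝ), ν {x | ENNReal.ofReal t < g x} * ENNReal.ofReal (t ^ (s - 1)) := by
  by_cases htop : ν {x | g x = ∞} = 0
  · have hfin : ∀ᵐ x ∂ν, g x ≠ ∞ := by simpa [ae_iff] using htop
    have hlevel : ∀ t : ℝ, 0 ≤ t →
        ν {x | ENNReal.ofReal t < g x} = ν {x | t < (g x).toReal} := fun t ht =>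
      measure_congr <| by
        filter_upwards [hfin] with x hx
        exact propext (ENNReal.ofReal_lt_iff_lt_toReal ht hx)
    calc ∫⁻ x, g x ^ s ∂ν = ∫⁻ x, ENNReal.ofReal ((g x).toReal ^ s) ∂ν := by
          refine lintegral_congr_ae ?_
          filter_upwards [hfin] with x hx
          rw [← ENNReal.ofReal_rpow_of_nonneg ENNReal.toReal_nonneg hs.le, ENNReal.ofReal_toReal hx]
      _ = ENNReal.ofReal s *
          ∫⁻ t in Set.Ioi 0, ν {x | t < (g x).toReal} * ENNReal.ofReal (t ^ (s - 1)) :=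
          lintegral_rpow_eq_lintegral_meas_lt_mul ν (.of_forall fun _ => ENNReal.toReal_nonneg)
            hg.ennreal_toReal.aemeasurable hs
      _ = _ := by
          congr 1
          refine setLIntegral_congr_fun measurableSet_Ioi fun t ht => ?_
          simp only [hlevel t (le_of_lt ht)]
  · have hleft : ∫⁻ x, g x ^ s ∂ν = ∞ := by
      refine lintegral_eq_top_of_measure_eq_top_ne_zero (by fun_prop) ?_
      simpa [ENNReal.rpow_eq_top_iff_of_pos hs] using htop
    have hright : ∫⁻ t in Set.Ioi (0 : ℝ),
        ν {x | ENNReal.ofReal t < g x} * ENNReal.ofReal (t ^ (s - 1)) = ∞ := by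
      refine top_le_iff.mp ?_
      calc ∞ = ν {x | g x = ∞} * ∫⁻ t in Set.Ioi (0 : ℝ), ENNReal.ofReal (t ^ (s - 1)) := by
            rw [setLIntegral_Ioi_ofReal_rpow_eq_top, ENNReal.mul_top htop]
        _ = ∫⁻ t in Set.Ioi (0 : ℝ), ν {x | g x = ∞} * ENNReal.ofReal (t ^ (s - 1)) :=
            (lintegral_const_mul _ (by fun_prop)).symm
        _ ≤ _ := by
            refine lintegral_mono fun t => mul_le_mul_left (measure_mono fun x hx => ?_) _
            rw [Set.mem_ofPred_eq] at hx ⊢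
            exact hx ▸ ENNReal.ofReal_lt_top
    rw [hleft, hright, ENNReal.mul_top (by simpa using hs)]

theorem lintegral_rpow_le_of_weak_type {ν : Measure α} {η : Measure β} {F : α → ℝ≥0∞}
    {g : β → ℝ≥0∞} (hF : Measurable F) (hg : Measurable g) {q : ℝ} (hq : 1 < q) {C : ℝ≥0}
    (h : ∀ t : ℝ, 0 < t → ENNReal.ofReal t * ν {x | ENNReal.ofReal t < F x} ≤
      C * η {x | ENNReal.ofReal t < g x}) :
    ∫⁻ x, F x ^ q ∂ν ≤ C * ENNReal.ofReal (q / (q - 1)) * ∫⁻ x, g x ^ (q - 1) ∂η := by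
  have hq1 : 0 < q - 1 := sub_pos.mpr hq
  have hpow : ∀ t : ℝ, 0 < t →
      ENNReal.ofReal (t ^ (q - 1)) = ENNReal.ofReal t * ENNReal.ofReal (t ^ (q - 1 - 1)) :=
    fun t ht => by
      rw [← ENNReal.ofReal_mul ht.le, Real.rpow_sub_one ht.ne' (q - 1), mul_div_cancel₀ _ ht.ne']
  rw [lintegral_rpow_eq_lintegral_measure_ofReal_lt ν hF (by linarith),
    lintegral_rpow_eq_lintegral_measure_ofReal_lt η hg hq1]
  calc ENNReal.ofReal q * ∫⁻ t in Set.Ioi (0 : ℝ),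
        ν {x | ENNReal.ofReal t < F x} * ENNReal.ofReal (t ^ (q - 1))
      ≤ ENNReal.ofReal q * ∫⁻ t in Set.Ioi (0 : ℝ),
        C * (η {x | ENNReal.ofReal t < g x} * ENNReal.ofReal (t ^ (q - 1 - 1))) := by
        refine mul_le_mul_right (setLIntegral_mono' measurableSet_Ioi fun t ht => ?_) _
        rw [hpow t ht, ← mul_assoc, ← mul_assoc, mul_comm (ν _)]
        exact mul_le_mul_left (h t ht) _
    _ = C * (ENNReal.ofReal (q / (q - 1)) * ENNReal.ofReal (q - 1)) *
        ∫⁻ t in Set.Ioi (0 : ℝ),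
          η {x | ENNReal.ofReal t < g x} * ENNReal.ofReal (t ^ (q - 1 - 1)) := by
        rw [lintegral_const_mul' _ _ ENNReal.coe_ne_top, ← ENNReal.ofReal_mul (by positivity),
          div_mul_cancel₀ _ hq1.ne']
        ring
    _ = _ := by ring

end LayerCake

section Averages

variable {α : Type*} [MeasurableSpace α] {μ : Measure α}

theorem laverage_le_of_forall_le {f : α → ℝ≥0∞} {c : ℝ≥0∞} (h : ∀ x, f x ≤ c) :
    ⨍⁻ x, f x ∂μ ≤ c :=
  (laverage_le_essSup f).trans (essSup_le_of_ae_le c (.of_forall h))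

theorem laverage_add {f : α → ℝ≥0∞} (hf : Measurable f) (g : α → ℝ≥0∞) :
    ⨍⁻ x, f x + g x ∂μ = ⨍⁻ x, f x ∂μ + ⨍⁻ x, g x ∂μ :=
  lintegral_add_left hf g

theorem laverage_rpow_mul_rpow_le {f g : α → ℝ≥0∞} (hf : Measurable f) (hg : Measurable g)
    {s t : ℝ} (hs : 0 ≤ s) (ht : 0 ≤ t) (hst : s + t = 1) :
    ⨍⁻ x, f x ^ s * g x ^ t ∂μ ≤ (⨍⁻ x, f x ∂μ) ^ s * (⨍⁻ x, g x ∂μ) ^ t :=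
  ENNReal.lintegral_mul_norm_pow_le hf.aemeasurable hg.aemeasurable hs ht hst

theorem setLAverage_le_mul_setLAverage {s t : Set α} {K : ℝ≥0∞} (hst : s ⊆ t) (hs : μ s ≠ 0)
    (ht : μ t ≠ ∞) (hK : μ t ≤ K * μ s) (f : α → ℝ≥0∞) :
    ⨍⁻ x in s, f x ∂μ ≤ K * ⨍⁻ x in t, f x ∂μ := by
  rw [setLAverage_eq, ENNReal.div_le_iff hs (measure_ne_top_of_subset hst ht)]
  calc ∫⁻ x in s, f x ∂μ ≤ ∫⁻ x in t, f x ∂μ := lintegral_mono_set hst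
    _ = μ t * ⨍⁻ x in t, f x ∂μ := (measure_mul_setLAverage f ht).symm
    _ ≤ K * μ s * ⨍⁻ x in t, f x ∂μ := by gcongr
    _ = K * (⨍⁻ x in t, f x ∂μ) * μ s := by ring

end Averages

section MaximalAverage

open scoped Pointwise

variable {G : Type*} [Group G] [MeasurableSpace G] {μ : Measure G} {ι : Type*} {B : ι → Set G}

/-- The maximal operator of a family of sets `B i` in a group: the supremum of the averages of `f`
over the translated reflected sets `x (B i)⁻¹`. -/
noncomputable def maximalAverage (μ : Measure G) (B : ι → Set G) (f : G → ℝ≥0∞) (x : G) : ℝ≥0∞ :=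
  ⨆ i, ⨍⁻ y in B i, f (x * y⁻¹) ∂μ

theorem setLAverage_le_maximalAverage (B : ι → Set G) (f : G → ℝ≥0∞) (x : G) (i : ι) :
    ⨍⁻ y in B i, f (x * y⁻¹) ∂μ ≤ maximalAverage μ B f x :=
  le_iSup (fun i => ⨍⁻ y in B i, f (x * y⁻¹) ∂μ) i

theorem maximalAverage_mono : Monotone (maximalAverage μ B) := fun _ _ hfg x =>
  iSup_mono fun _ => lintegral_mono fun y => hfg (x * y⁻¹)

theorem maximalAverage_le_of_forall_le {f : G → ℝ≥0∞} {c : ℝ≥0∞} (h : ∀ x, f x ≤ c) (x : G) :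
    maximalAverage μ B f x ≤ c :=
  iSup_le fun _ => laverage_le_of_forall_le fun _ => h _

variable [MeasurableMul₂ G] [MeasurableInv G]

theorem measurable_setLAverage_mul_inv [SFinite μ] (s : Set G) {f : G → ℝ≥0∞}
    (hf : Measurable f) : Measurable fun x => ⨍⁻ y in s, f (x * y⁻¹) ∂μ := by
  simp_rw [setLAverage_eq]
  exact (Measurable.lintegral_prod_right' (f := fun z : G × G => f (z.1 * z.2⁻¹))
    (by fun_prop)).div_const _

theorem measurable_maximalAverage [SFinite μ] [Countable ι] (B : ι → Set G) {f : G → ℝ≥0∞}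
    (hf : Measurable f) : Measurable (maximalAverage μ B f) :=
  .iSup fun i => measurable_setLAverage_mul_inv (B i) hf

theorem maximalAverage_add_le {f : G → ℝ≥0∞} (hf : Measurable f) (g : G → ℝ≥0∞) (x : G) :
    maximalAverage μ B (f + g) x ≤ maximalAverage μ B f x + maximalAverage μ B g x :=
  iSup_le fun i => (laverage_add (by fun_prop) fun y => g (x * y⁻¹)).trans_le <|
    add_le_add (setLAverage_le_maximalAverage B f x i) (setLAverage_le_maximalAverage B g x i)

theorem maximalAverage_rpow_mul_rpow_le {f g : G → ℝ≥0∞} (hf : Measurable f) (hg : Measurable g)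
    {s t : ℝ} (hs : 0 ≤ s) (ht : 0 ≤ t) (hst : s + t = 1) (x : G) :
    maximalAverage μ B (fun y => f y ^ s * g y ^ t) x ≤
      maximalAverage μ B f x ^ s * maximalAverage μ B g x ^ t := by
  refine iSup_le fun i => (laverage_rpow_mul_rpow_le (f := fun y => f (x * y⁻¹))
    (g := fun y => g (x * y⁻¹)) (by fun_prop) (by fun_prop) hs ht hst).trans ?_
  gcongr
  · exact setLAverage_le_maximalAverage B f x i
  · exact setLAverage_le_maximalAverage B g x i

theorem setLIntegral_mul_inv_eq_setLIntegral_smul_inv [μ.IsMulLeftInvariant] [μ.IsInvInvariant]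
    (s : Set G) (f : G → ℝ≥0∞) (x : G) :
    ∫⁻ y in s, f (x * y⁻¹) ∂μ = ∫⁻ z in x • s⁻¹, f z ∂μ := by
  have hpreimage : (fun y => x / y) ⁻¹' (x • s⁻¹) = s := by
    ext y
    simp [Set.mem_smul_set_iff_inv_smul_mem, div_eq_mul_inv]
  rw [← (Measure.measurePreserving_div_left μ x).setLIntegral_comp_preimage_emb
    (MeasurableEquiv.divLeft x).measurableEmbedding f, hpreimage]
  simp only [div_eq_mul_inv]

theorem setLIntegral_setLIntegral_mul_eq [SFinite μ] [μ.IsMulRightInvariant] (s : Set G)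
    {t : Set G} (ht : MeasurableSet t) {f : G → ℝ≥0∞} (hf : Measurable f) :
    ∫⁻ y in s, ∫⁻ z in t, f (z * y) ∂μ ∂μ =
      ∫⁻ w, μ (s ∩ {y | w * y⁻¹ ∈ t}) * f w ∂μ := by
  have hmeas : Measurable (t.indicator (1 : G → ℝ≥0∞)) := measurable_one.indicator ht
  have hinner : ∀ y, ∫⁻ z in t, f (z * y) ∂μ =
      ∫⁻ w, t.indicator 1 (w * y⁻¹) * f w ∂μ := fun y => by
    rw [← lintegral_indicator ht, ← lintegral_mul_right_eq_self _ y⁻¹]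
    refine lintegral_congr fun w => ?_
    by_cases hw : w * y⁻¹ ∈ t <;> simp [hw]
  have houter : ∀ w, ∫⁻ y in s, t.indicator 1 (w * y⁻¹) ∂μ =
      μ (s ∩ {y | w * y⁻¹ ∈ t}) := fun w => by
    have ht' : MeasurableSet {y | w * y⁻¹ ∈ t} :=
      (measurable_const_mul w).comp measurable_inv ht
    rw [Set.inter_comm, ← Measure.restrict_apply ht', ← lintegral_indicator_one ht']
    rfl
  simp_rw [hinner]
  rw [lintegral_lintegral_swap ((hmeas.comp (measurable_snd.mul measurable_fst.inv)).mul
    (hf.comp measurable_snd)).aemeasurable]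
  refine lintegral_congr fun w => ?_
  rw [← houter]
  exact lintegral_mul_const _ (hmeas.comp (measurable_inv.const_mul w))

/- The iterated average is the average against the convolution of the two normalized indicators,
which is bounded below on `R`. -/
theorem setLAverage_le_mul_setLAverage_setLAverage [SFinite μ] [μ.IsMulRightInvariant]
    {R s t : Set G} {u K : ℝ≥0∞} (hR : MeasurableSet R) (ht : MeasurableSet t) (hs0 : μ s ≠ 0)
    (hs' : μ s ≠ ∞) (ht0 : μ t ≠ 0) (ht' : μ t ≠ ∞) (hK : μ s * μ t ≤ K * (u * μ R))
    (h : ∀ w ∈ R, u ≤ μ (s ∩ {y | w * y⁻¹ ∈ t})) {f : G → ℝ≥0∞} (hf : Measurable f) (x : G) :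
    ⨍⁻ w in R, f (x * w⁻¹) ∂μ ≤ K * ⨍⁻ y in s, ⨍⁻ z in t, f (x * y⁻¹ * z⁻¹) ∂μ ∂μ := by
  have hconv : u * ∫⁻ w in R, f (x * w⁻¹) ∂μ ≤
      ∫⁻ y in s, ∫⁻ z in t, f (x * y⁻¹ * z⁻¹) ∂μ ∂μ :=
    calc u * ∫⁻ w in R, f (x * w⁻¹) ∂μ = ∫⁻ w in R, u * f (x * w⁻¹) ∂μ :=
          (lintegral_const_mul u (by fun_prop)).symm
      _ ≤ ∫⁻ w in R, μ (s ∩ {y | w * y⁻¹ ∈ t}) * f (x * w⁻¹) ∂μ :=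
          setLIntegral_mono' hR fun w hw => mul_le_mul_left (h w hw) _
      _ ≤ ∫⁻ w, μ (s ∩ {y | w * y⁻¹ ∈ t}) * f (x * w⁻¹) ∂μ := setLIntegral_le_lintegral R _
      _ = ∫⁻ y in s, ∫⁻ z in t, f (x * y⁻¹ * z⁻¹) ∂μ ∂μ := by
          rw [← setLIntegral_setLIntegral_mul_eq s ht (f := fun w => f (x * w⁻¹)) (by fun_prop)]
          simp only [mul_inv_rev, mul_assoc]
  have hiter : ⨍⁻ y in s, ⨍⁻ z in t, f (x * y⁻¹ * z⁻¹) ∂μ ∂μ =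
      (μ s * μ t)⁻¹ * ∫⁻ y in s, ∫⁻ z in t, f (x * y⁻¹ * z⁻¹) ∂μ ∂μ := by
    simp_rw [setLAverage_eq, div_eq_mul_inv]
    rw [lintegral_mul_const' _ _ (ENNReal.inv_ne_top.mpr ht0),
      ENNReal.mul_inv (.inl hs0) (.inl hs')]
    ring
  rw [setLAverage_eq]
  refine ENNReal.div_le_of_le_mul ?_
  calc ∫⁻ w in R, f (x * w⁻¹) ∂μ = (μ s * μ t)⁻¹ * (μ s * μ t) * ∫⁻ w in R, f (x * w⁻¹) ∂μ := by
        rw [ENNReal.inv_mul_cancel (mul_ne_zero hs0 ht0) (ENNReal.mul_ne_top hs' ht'), one_mul]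
    _ ≤ (μ s * μ t)⁻¹ * (K * (u * μ R)) * ∫⁻ w in R, f (x * w⁻¹) ∂μ := by gcongr
    _ = K * ((μ s * μ t)⁻¹ * (u * ∫⁻ w in R, f (x * w⁻¹) ∂μ)) * μ R := by ring
    _ ≤ K * (⨍⁻ y in s, ⨍⁻ z in t, f (x * y⁻¹ * z⁻¹) ∂μ ∂μ) * μ R := by rw [hiter]; gcongr

end MaximalAverage

section MaximalTheorem

open scoped Pointwise

variable {G : Type*} [Group G]

theorem mem_smul_inv_iff {s : Set G} {x z : G} : z ∈ x • s⁻¹ ↔ z⁻¹ * x ∈ s := by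
  simp [Set.mem_smul_set_iff_inv_smul_mem]

variable [MeasurableSpace G]

/-- An increasing sequence of sets `B i` of positive finite measure that are engulfed, in the sense
of Vitali's covering lemma, by sets `W i` of comparable measure. -/
structure Engulfing (μ : Measure G) (K : ℝ≥0) (B W : ℕ → Set G) : Prop where
  measurableSet : ∀ i, MeasurableSet (B i)
  monotone : Monotone B
  measure_ne_zero : ∀ i, μ (B i) ≠ 0
  measure_ne_top : ∀ i, μ (B i) ≠ ∞
  measure_le : ∀ i, μ (W i) ≤ K * μ (B i)
  inv_mul_inv_subset : ∀ i, (B i)⁻¹ * B i * (B i)⁻¹ ⊆ W i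

namespace Engulfing

variable {μ : Measure G} {K : ℝ≥0} {B W : ℕ → Set G} {f w : G → ℝ≥0∞}

theorem mem_iInter_smul_inv (h : Engulfing μ K B W) {i j : ℕ} (hij : i ≤ j) {x b : G}
    (hxb : (x • (B i)⁻¹ ∩ b • (B j)⁻¹).Nonempty) :
    x ∈ ⋂ z ∈ b • (B j)⁻¹, z • (W j)⁻¹ := by
  obtain ⟨v, hvx, hvb⟩ := hxb
  rw [mem_smul_inv_iff] at hvx hvb
  refine Set.mem_iInter₂.mpr fun z hz => ?_
  rw [mem_smul_inv_iff] at hz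
  have hW := h.inv_mul_inv_subset j <| Set.mul_mem_mul (Set.mul_mem_mul
    (Set.inv_mem_inv.mpr (h.monotone hij hvx)) hvb) (Set.inv_mem_inv.mpr hz)
  rw [Set.mem_smul_set_iff_inv_smul_mem, Set.mem_inv]
  convert hW using 1
  simp [mul_assoc]

variable [MeasurableMul₂ G] [MeasurableInv G]

theorem measurableSet_smul_inv (h : Engulfing μ K B W) (x : G) (i : ℕ) :
    MeasurableSet (x • (B i)⁻¹) :=
  (h.measurableSet i).inv.const_smul x

variable [μ.IsMulLeftInvariant] [μ.IsInvInvariant]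

theorem mul_setLIntegral_iInter_le (h : Engulfing μ K B W) {t : ℝ≥0∞} {b : G} {i : ℕ}
    (ht : t ≤ ⨍⁻ y in B i, f (b * y⁻¹) ∂μ) :
    t * ∫⁻ x in ⋂ z ∈ b • (B i)⁻¹, z • (W i)⁻¹, w x ∂μ ≤
      K * ∫⁻ z in b • (B i)⁻¹, f z * maximalAverage μ W w z ∂μ := by
  set V := ⋂ z ∈ b • (B i)⁻¹, z • (W i)⁻¹
  have hWtop : μ (W i) ≠ ∞ := ne_top_of_le_ne_top
    (ENNReal.mul_ne_top ENNReal.coe_ne_top (h.measure_ne_top i)) (h.measure_le i)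
  have hV : ∀ z ∈ b • (B i)⁻¹, ∫⁻ x in V, w x ∂μ ≤ K * μ (B i) * maximalAverage μ W w z :=
    fun z hz => by
      calc ∫⁻ x in V, w x ∂μ ≤ ∫⁻ x in z • (W i)⁻¹, w x ∂μ :=
            lintegral_mono_set (Set.biInter_subset_of_mem hz)
        _ = μ (W i) * ⨍⁻ y in W i, w (z * y⁻¹) ∂μ := by
            rw [measure_mul_setLAverage _ hWtop, setLIntegral_mul_inv_eq_setLIntegral_smul_inv]
        _ ≤ K * μ (B i) * maximalAverage μ W w z :=
            mul_le_mul' (h.measure_le i) (setLAverage_le_maximalAverage W w z i)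
  calc t * ∫⁻ x in V, w x ∂μ
      ≤ ((μ (B i))⁻¹ * ∫⁻ z in b • (B i)⁻¹, f z ∂μ) * ∫⁻ x in V, w x ∂μ := by
        rw [setLAverage_eq, setLIntegral_mul_inv_eq_setLIntegral_smul_inv, div_eq_mul_inv,
          mul_comm] at ht
        gcongr
    _ = (μ (B i))⁻¹ * ((∫⁻ z in b • (B i)⁻¹, f z ∂μ) * ∫⁻ x in V, w x ∂μ) := mul_assoc _ _ _
    _ ≤ (μ (B i))⁻¹ * ∫⁻ z in b • (B i)⁻¹, f z * ∫⁻ x in V, w x ∂μ ∂μ := by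
        gcongr
        exact lintegral_mul_const_le _ _
    _ ≤ (μ (B i))⁻¹ * ∫⁻ z in b • (B i)⁻¹,
          (K * μ (B i)) * (f z * maximalAverage μ W w z) ∂μ := by
        refine mul_le_mul_right (setLIntegral_mono' (h.measurableSet_smul_inv b i)
          fun z hz => ?_) _
        rw [mul_left_comm]
        exact mul_le_mul_right (hV z hz) _
    _ = (μ (B i))⁻¹ * μ (B i) * (K * ∫⁻ z in b • (B i)⁻¹, f z * maximalAverage μ W w z ∂μ) := by
        rw [lintegral_const_mul' _ _ (ENNReal.mul_ne_top ENNReal.coe_ne_top (h.measure_ne_top i))]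
        ring
    _ = K * ∫⁻ z in b • (B i)⁻¹, f z * maximalAverage μ W w z ∂μ := by
        rw [ENNReal.inv_mul_cancel (h.measure_ne_zero i) (h.measure_ne_top i), one_mul]

variable [SigmaFinite μ]

theorem exists_disjoint_subfamily (h : Engulfing μ K B W) {E : Set G} {r : G → ℕ} {I : ℕ}
    (hr : ∀ x ∈ E, r x ≤ I) :
    ∃ u ⊆ E, u.Countable ∧ u.PairwiseDisjoint (fun b => b • (B (r b))⁻¹) ∧
      E ⊆ ⋃ b ∈ u, ⋂ z ∈ b • (B (r b))⁻¹, z • (W (r b))⁻¹ := by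
  have hpos : ∀ b, 0 < μ (b • (B (r b))⁻¹) := fun b => by
    rw [measure_smul, Measure.measure_inv]
    exact pos_iff_ne_zero.mpr (h.measure_ne_zero _)
  obtain ⟨u, huE, hdisj, hu⟩ := Vitali.exists_disjoint_subfamily_covering_enlargement
    (fun x => x • (B (r x))⁻¹) E (fun x => (2 : ℝ) ^ r x) (3 / 2) (by norm_num)
    (fun _ _ => by positivity) (2 ^ I)
    (fun x hx => pow_le_pow_right₀ one_le_two (hr x hx))
    (fun x _ => nonempty_of_measure_ne_zero (hpos x).ne')
  have hcount : u.Countable := by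
    have huniv := Measure.countable_meas_pos_of_disjoint_iUnion (μ := μ)
      (As := fun b : u => b.1 • (B (r b))⁻¹) (fun b => h.measurableSet_smul_inv b.1 _)
      (fun b b' hbb' => hdisj b.2 b'.2 (Subtype.coe_ne_coe.mpr hbb'))
    simpa only [hpos, Set.ofPred_true, Set.countable_univ_iff, Set.countable_coe_iff] using huniv
  refine ⟨u, huE, hcount, hdisj, fun x hx => ?_⟩
  obtain ⟨b, hb, hxb, hle⟩ := hu x hx
  have hrb : r x ≤ r b := by
    by_contra! hlt
    have hpow : (2 : ℝ) ^ (r b + 1) ≤ 2 ^ r x := pow_le_pow_right₀ one_le_two hlt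
    rw [pow_succ] at hpow
    linarith [pow_pos (zero_lt_two' ℝ) (r b)]
  exact Set.mem_biUnion hb (h.mem_iInter_smul_inv hrb hxb)

theorem weak_type_le (h : Engulfing μ K B W) (f w : G → ℝ≥0∞) (t : ℝ≥0∞) (I : ℕ) :
    t * ∫⁻ x in {x | ∃ i ≤ I, t < ⨍⁻ y in B i, f (x * y⁻¹) ∂μ}, w x ∂μ ≤
      K * ∫⁻ x, f x * maximalAverage μ W w x ∂μ := by
  set E : Set G := {x | ∃ i ≤ I, t < ⨍⁻ y in B i, f (x * y⁻¹) ∂μ}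
  choose! r hrI hr using fun (x : G) (hx : x ∈ E) => hx
  obtain ⟨u, huE, hcount, hdisj, hcover⟩ := h.exists_disjoint_subfamily hrI
  have : Countable u := hcount.to_subtype
  calc t * ∫⁻ x in E, w x ∂μ
      ≤ t * ∑' b : u, ∫⁻ x in ⋂ z ∈ b.1 • (B (r b))⁻¹, z • (W (r b))⁻¹, w x ∂μ := by
        gcongr
        rw [Set.biUnion_eq_iUnion] at hcover
        exact (lintegral_mono_set hcover).trans (lintegral_iUnion_le _ _)
    _ ≤ ∑' b : u, K * ∫⁻ z in b.1 • (B (r b))⁻¹, f z * maximalAverage μ W w z ∂μ := by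
        rw [← ENNReal.tsum_mul_left]
        exact ENNReal.tsum_le_tsum fun b => h.mul_setLIntegral_iInter_le (hr b.1 (huE b.2)).le
    _ = K * ∫⁻ z in ⋃ b : u, b.1 • (B (r b))⁻¹, f z * maximalAverage μ W w z ∂μ := by
        rw [ENNReal.tsum_mul_left, lintegral_iUnion (fun b : u => h.measurableSet_smul_inv b.1 _)
          fun b b' hbb' => hdisj b.2 b'.2 (Subtype.coe_ne_coe.mpr hbb')]
    _ ≤ K * ∫⁻ x, f x * maximalAverage μ W w x ∂μ := by
        gcongr
        exact Measure.restrict_le_self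

theorem weak_type (h : Engulfing μ K B W) (f w : G → ℝ≥0∞) (t : ℝ≥0∞) :
    t * ∫⁻ x in {x | t < maximalAverage μ B f x}, w x ∂μ ≤
      K * ∫⁻ x, f x * maximalAverage μ W w x ∂μ := by
  have hlevel : {x | t < maximalAverage μ B f x} =
      ⋃ I : ℕ, {x | ∃ i ≤ I, t < ⨍⁻ y in B i, f (x * y⁻¹) ∂μ} := by
    ext x
    simp only [maximalAverage, lt_iSup_iff, Set.mem_ofPred_eq, Set.mem_iUnion]
    exact ⟨fun ⟨i, hi⟩ => ⟨i, i, le_rfl, hi⟩, fun ⟨_, i, _, hi⟩ => ⟨i, hi⟩⟩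
  rw [hlevel, setLIntegral_iUnion_of_directed, ENNReal.mul_iSup]
  · exact iSup_le fun I => h.weak_type_le f w t I
  · exact Monotone.directed_le fun I J hIJ x ⟨i, hi, hx⟩ => ⟨i, hi.trans hIJ, hx⟩

theorem weak_type_truncated (h : Engulfing μ K B W) (hf : Measurable f) (w : G → ℝ≥0∞)
    (t : ℝ≥0∞) :
    t * ∫⁻ x in {x | t < maximalAverage μ B f x}, w x ∂μ ≤
      (2 * K : ℝ≥0) * ∫⁻ x in {x | t < 2 * f x}, f x * maximalAverage μ W w x ∂μ := by
  set S : Set G := {x | t < 2 * f x}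
  have hS : MeasurableSet S := measurableSet_lt measurable_const (by fun_prop)
  have hsmall : ∀ x, Sᶜ.indicator f x ≤ t / 2 := fun x => by
    refine Set.indicator_apply_le' (fun hx => ?_) fun _ => zero_le
    rw [ENNReal.le_div_iff_mul_le (by simp) (by simp), mul_comm]
    exact not_lt.mp hx
  have htrunc : ∀ x, maximalAverage μ B f x ≤ maximalAverage μ B (S.indicator f) x + t / 2 :=
    fun x => by
      have hadd := maximalAverage_add_le (μ := μ) (B := B) (hf.indicator hS) (Sᶜ.indicator f) x
      rw [Set.indicator_self_add_compl] at hadd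
      exact hadd.trans (add_le_add_right (maximalAverage_le_of_forall_le hsmall x) _)
  have hsubset : {x | t < maximalAverage μ B f x} ⊆
      {x | t / 2 < maximalAverage μ B (S.indicator f) x} := fun x hx => by
    by_contra hle
    refine lt_irrefl t (hx.trans_le ((htrunc x).trans ?_))
    calc _ ≤ t / 2 + t / 2 := add_le_add_left (not_lt.mp hle) _
      _ = t := ENNReal.add_halves t
  calc t * ∫⁻ x in {x | t < maximalAverage μ B f x}, w x ∂μ
      ≤ t * ∫⁻ x in {x | t / 2 < maximalAverage μ B (S.indicator f) x}, w x ∂μ := by gcongr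
    _ = 2 * (t / 2 * ∫⁻ x in {x | t / 2 < maximalAverage μ B (S.indicator f) x}, w x ∂μ) := by
        rw [← mul_assoc, ENNReal.mul_div_cancel two_ne_zero ENNReal.ofNat_ne_top]
    _ ≤ 2 * (K * ∫⁻ x, S.indicator f x * maximalAverage μ W w x ∂μ) := by
        exact mul_le_mul_right (h.weak_type _ _ _) 2
    _ = (2 * K : ℝ≥0) * ∫⁻ x in S, f x * maximalAverage μ W w x ∂μ := by
        rw [← lintegral_indicator hS, ← mul_assoc]
        simp only [Set.indicator_mul_left, ENNReal.coe_mul, ENNReal.coe_ofNat]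

theorem lintegral_maximalAverage_rpow_mul_le (h : Engulfing μ K B W) {q : ℝ} (hq : 1 < q)
    (hf : Measurable f) (hw : Measurable w) :
    ∫⁻ x, maximalAverage μ B f x ^ q * w x ∂μ ≤
      (2 * K * (q / (q - 1)).toNNReal * 2 ^ (q - 1) : ℝ≥0) *
        ∫⁻ x, f x ^ q * maximalAverage μ W w x ∂μ := by
  have hBf : Measurable (maximalAverage μ B f) := measurable_maximalAverage B hf
  have hWw : Measurable (maximalAverage μ W w) := measurable_maximalAverage W hw
  have hq1 : 0 ≤ q - 1 := by linarith
  have hpow : ∀ x, (2 * f x) ^ (q - 1) * (f x * maximalAverage μ W w x) =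
      2 ^ (q - 1) * (f x ^ q * maximalAverage μ W w x) := fun x => by
    have hfq : f x ^ q = f x ^ (q - 1) * f x := by
      conv_rhs => rw [← ENNReal.rpow_one (f x), ← ENNReal.rpow_mul, one_mul]
      rw [← ENNReal.rpow_add_of_nonneg _ _ hq1 zero_le_one, sub_add_cancel]
    rw [ENNReal.mul_rpow_of_nonneg _ _ hq1, hfq]
    ring
  have hweak := lintegral_rpow_le_of_weak_type (ν := μ.withDensity w)
    (η := μ.withDensity fun x => f x * maximalAverage μ W w x) hBf (hf.const_mul 2) hq
    (C := 2 * K) fun t _ => by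
      simpa only [withDensity_apply'] using h.weak_type_truncated hf w (ENNReal.ofReal t)
  rw [lintegral_withDensity_eq_lintegral_mul μ hw (hBf.pow_const q),
    lintegral_withDensity_eq_lintegral_mul _ (by fun_prop) ((hf.const_mul 2).pow_const _)] at hweak
  simp only [Pi.mul_apply, mul_comm (w _)] at hweak
  refine hweak.trans_eq ?_
  simp only [mul_comm (f _ * _), hpow]
  rw [lintegral_const_mul _ (by fun_prop), ← mul_assoc]
  rw [ENNReal.coe_mul, ENNReal.coe_mul, ENNReal.coe_rpow_of_nonneg _ hq1]
  rfl

theorem strongTypeBound (h : Engulfing μ K B W) {q : ℝ} (hq : 1 < q) :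
    StrongTypeBound μ q (2 * K * (q / (q - 1)).toNNReal * 2 ^ (q - 1)) (maximalAverage μ B) := by
  intro f hf
  calc ∫⁻ x, maximalAverage μ B f x ^ q ∂μ = ∫⁻ x, maximalAverage μ B f x ^ q * 1 ∂μ := by
        simp only [mul_one]
    _ ≤ _ * ∫⁻ x, f x ^ q * maximalAverage μ W (fun _ => 1) x ∂μ :=
        h.lintegral_maximalAverage_rpow_mul_le hq hf measurable_const
    _ ≤ _ * ∫⁻ x, f x ^ q ∂μ := by
        gcongr with x
        exact mul_le_of_le_one_right' (maximalAverage_le_of_forall_le (fun _ => le_rfl) x)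

theorem exists_squareFunctionBound_of_lt_two {p : ℝ} (hp1 : 1 < p) (hp2 : p < 2) (K : ℝ≥0) :
    ∃ C : ℝ≥0, ∀ B W : ℕ → Set G, Engulfing μ K B W →
      SquareFunctionBound μ p C (maximalAverage μ B) := by
  have hp0 : 0 < p := by linarith
  have hinv : 1 / p < 1 := (div_lt_one hp0).mpr hp1
  have hθ : 1 / (2 * p) = 1 / p / 2 := by field_simp
  have hexp : 1 / (2 * p) * p / (1 - p / 2) = 1 / (2 - p) := by
    have h2p := (sub_pos.mpr hp2).ne'
    field_simp
  refine ⟨_, fun B W h => .of_strongTypeBound (θ := 1 / (2 * p)) hp0 hp2 (by positivity)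
    (by linarith) (fun f hf => measurable_maximalAverage B hf) maximalAverage_mono
    (fun f g hf hg => maximalAverage_rpow_mul_rpow_le hf hg (by linarith) (by positivity)
      (sub_add_cancel _ _)) (h.strongTypeBound (by linarith)) (h.strongTypeBound ?_)⟩
  rw [hexp, one_lt_div (sub_pos.mpr hp2)]
  linarith

theorem exists_squareFunctionBound_of_two_lt {p : ℝ} (hp : 2 < p) (K : ℝ≥0) :
    ∃ C : ℝ≥0, ∀ B W W' : ℕ → Set G, Engulfing μ K B W → Engulfing μ K W W' →
      SquareFunctionBound μ p C (maximalAverage μ B) := by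
  obtain ⟨q, rfl⟩ : ∃ q, p = 2 * q := ⟨p / 2, by ring⟩
  have hq : q.HolderConjugate q.conjExponent := .conjExponent (by linarith)
  refine ⟨_, fun B W W' h h' => .of_weighted hq
    (A := 2 * K * (2 / (2 - 1) : ℝ).toNNReal * 2 ^ (2 - 1 : ℝ))
    (fun f hf => measurable_maximalAverage B hf) (fun f hf => measurable_maximalAverage W hf)
    (fun f w hf hw => ?_) (h'.strongTypeBound hq.symm.lt)⟩
  simpa only [ENNReal.rpow_two] using h.lintegral_maximalAverage_rpow_mul_le one_lt_two hf hw

theorem exists_squareFunctionBound {p : ℝ} (hp : 1 < p) (K : ℝ≥0) :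
    ∃ C : ℝ≥0, ∀ B W W' : ℕ → Set G, Engulfing μ K B W → Engulfing μ K W W' →
      SquareFunctionBound μ p C (maximalAverage μ B) := by
  rcases lt_trichotomy p 2 with hp2 | rfl | hp2
  · obtain ⟨C, hC⟩ := exists_squareFunctionBound_of_lt_two (μ := μ) hp hp2 K
    exact ⟨C, fun B W _ h _ => hC B W h⟩
  · exact ⟨_, fun B _ _ h _ => .of_strongTypeBound_two
      (fun f hf => measurable_maximalAverage B hf) (h.strongTypeBound hp)⟩
  · exact exists_squareFunctionBound_of_two_lt hp2 K

end Engulfing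

end MaximalTheorem

section HomogeneousLaw

open Filter Topology

theorem fderiv_apply_of_semiconj {E F : Type*} [NormedAddCommGroup E] [NormedSpace ℝ E]
    [NormedAddCommGroup F] [NormedSpace ℝ F] {f : E → F} {L : E →L[ℝ] E} {M : F →L[ℝ] F}
    (hf : Differentiable ℝ f) (h : Function.Semiconj f L M) (x v : E) :
    fderiv ℝ f (L x) (L v) = M (fderiv ℝ f x v) := by
  have hfL := (hf (L x)).hasFDerivAt.comp x L.hasFDerivAt
  have hMf := M.hasFDerivAt.comp x (hf x).hasFDerivAt
  exact DFunLike.congr_fun ((h.comp_eq ▸ hfL).unique hMf) v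

theorem measurePreserving_of_abs_det_fderiv_eq_one {E : Type*} [NormedAddCommGroup E]
    [NormedSpace ℝ E] [FiniteDimensional ℝ E] [MeasurableSpace E] [BorelSpace E] (μ : Measure E)
    [μ.IsAddHaarMeasure] {φ : E → E} (hφ : Function.Bijective φ) (hd : Differentiable ℝ φ)
    (hdet : ∀ x, |(fderiv ℝ φ x).det| = 1) : MeasurePreserving φ μ μ := by
  refine ⟨hd.continuous.measurable, Measure.ext fun A hA => ?_⟩
  have hchange := lintegral_image_eq_lintegral_abs_det_fderiv_mul μ MeasurableSet.univ
    (fun x _ => (hd x).hasFDerivAt.hasFDerivWithinAt) hφ.injective.injOn (A.indicator 1)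
  simp only [Set.image_univ, hφ.surjective.range_eq, Measure.restrict_univ, hdet,
    ENNReal.ofReal_one, one_mul] at hchange
  rw [Measure.map_apply hd.continuous.measurable hA, ← lintegral_indicator_one hA, hchange,
    ← lintegral_indicator_one (hd.continuous.measurable hA)]
  rfl

theorem eq_of_tendsto_nhdsGT_of_forall_eq {X : Type*} [TopologicalSpace X] [T2Space X] {f : ℝ → X}
    {x y : X} {r₀ : ℝ} (hf : Tendsto f (𝓝[>] r₀) (𝓝 x)) (h : ∀ r > r₀, f r = y) : x = y :=
  tendsto_nhds_unique hf <| tendsto_const_nhds.congr' <|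
    eventually_nhdsWithin_of_forall fun r hr => (h r hr).symm

variable {n : ℕ} {a d : Fin n → ℕ}

theorem blockDilation_inv_cancel {r : ℝ} (hr : r ≠ 0) (x : BlockSpace a) :
    blockDilation d r (blockDilation d r⁻¹ x) = x := by
  funext k
  simp [blockDilation, smul_smul, hr]

theorem blockDilation_zero (hd : ∀ k, 0 < d k) (x : BlockSpace a) :
    blockDilation d 0 x = 0 := by
  funext k
  simp [blockDilation, (hd k).ne']

theorem continuous_blockDilation (x : BlockSpace a) :
    Continuous fun r : ℝ => blockDilation d r x := by
  unfold blockDilation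
  fun_prop

theorem tendsto_blockDilation (hd : ∀ k, 0 < d k) (x : BlockSpace a) :
    Tendsto (fun r : ℝ => blockDilation d r x) (𝓝[>] 0) (𝓝 0) := by
  have hlim := (continuous_blockDilation (d := d) x).tendsto 0
  rw [blockDilation_zero hd] at hlim
  exact hlim.mono_left nhdsWithin_le_nhds

theorem exists_continuous_blockDilation_eq_pow_smul (hd : Monotone d) {k : Fin n}
    {x : BlockSpace a} (hx : ∀ i ≤ k, x i = 0) :
    ∃ u : ℝ → BlockSpace a, Continuous u ∧ u 0 k = 0 ∧
      ∀ r, blockDilation d r x = r ^ d k • u r := by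
  refine ⟨fun r i => r ^ (d i - d k) • x i, by fun_prop, by simp [hx k le_rfl], fun r => ?_⟩
  funext i
  obtain hi | hi := le_or_gt i k
  · simp [blockDilation, hx i hi]
  · simp [blockDilation, smul_smul, ← pow_add, Nat.add_sub_cancel' (hd hi.le)]

/-- The dilation `blockDilation d r` as a continuous linear map, the form in which it can be
differentiated and has a determinant. -/
noncomputable def blockDilationCLM (a d : Fin n → ℕ) (r : ℝ) : BlockSpace a →L[ℝ] BlockSpace a :=
  ContinuousLinearMap.pi fun k => r ^ d k • ContinuousLinearMap.proj k

theorem coe_blockDilationCLM (r : ℝ) : ⇑(blockDilationCLM a d r) = blockDilation d r := rfl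

theorem det_blockDilationCLM_ne_zero {r : ℝ} (hr : r ≠ 0) :
    (blockDilationCLM a d r).det ≠ 0 := by
  have hcomp : (blockDilationCLM a d r : BlockSpace a →ₗ[ℝ] BlockSpace a) ∘ₗ
      (blockDilationCLM a d r⁻¹ : BlockSpace a →ₗ[ℝ] BlockSpace a) = LinearMap.id :=
    LinearMap.ext fun x => blockDilation_inv_cancel hr x
  have hdet := congrArg LinearMap.det hcomp
  rw [LinearMap.det_comp, LinearMap.det_id] at hdet
  exact left_ne_zero_of_mul_eq_one hdet

theorem det_eq_of_conj_blockDilation {Z : Type*} [TopologicalSpace Z]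
    {A : Z → BlockSpace a →L[ℝ] BlockSpace a} (hA : Continuous A) {z z₀ : Z} {c : ℝ → Z}
    (hc : Tendsto c (𝓝[>] 0) (𝓝 z₀))
    (h : ∀ r : ℝ, 0 < r → ∀ v, A (c r) (blockDilation d r v) = blockDilation d r (A z v)) :
    (A z).det = (A z₀).det := by
  have hconj : ∀ r : ℝ, 0 < r → (A (c r)).det = (A z).det := by
    intro r hr
    have hcomp : (A (c r) : BlockSpace a →ₗ[ℝ] BlockSpace a) ∘ₗ
        (blockDilationCLM a d r : BlockSpace a →ₗ[ℝ] BlockSpace a) =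
        (blockDilationCLM a d r : BlockSpace a →ₗ[ℝ] BlockSpace a) ∘ₗ
        (A z : BlockSpace a →ₗ[ℝ] BlockSpace a) := LinearMap.ext fun v => h r hr v
    have hdet := congrArg LinearMap.det hcomp
    rw [LinearMap.det_comp, LinearMap.det_comp, mul_comm] at hdet
    exact mul_left_cancel₀ (det_blockDilationCLM_ne_zero hr.ne') hdet
  have hlim : Tendsto (fun r => (A (c r)).det) (𝓝[>] 0) (𝓝 (A z₀).det) :=
    ((ContinuousLinearMap.continuous_det.comp hA).tendsto z₀).comp hc
  exact (eq_of_tendsto_nhdsGT_of_forall_eq hlim hconj).symm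

/-- The group law on `BlockSpace a` is smooth and has the dilations with positive nondecreasing
exponents `d` as automorphisms. This is the unbundled form of `HomogeneousGroup`, a class so that
the topological and measure-theoretic instances of the group can be inferred. -/
class IsHomogeneousLaw (a : Fin n → ℕ) (d : outParam (Fin n → ℕ)) [Group (BlockSpace a)] :
    Prop where
  contDiff_mul : ContDiff ℝ ((⊤ : ℕ∞) : WithTop ℕ∞)
    (fun z : BlockSpace a × BlockSpace a => z.1 * z.2)
  contDiff_inv : ContDiff ℝ ((⊤ : ℕ∞) : WithTop ℕ∞) (fun z : BlockSpace a => z⁻¹)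
  dilation_mul : ∀ r : ℝ, 0 < r → ∀ x y : BlockSpace a,
    blockDilation d r (x * y) = blockDilation d r x * blockDilation d r y
  pos : ∀ k, 0 < d k
  mono : Monotone d

namespace IsHomogeneousLaw

variable [Group (BlockSpace a)]

/-- The group law as a function of a pair, the form in which it is differentiated. -/
def mulPair (a : Fin n → ℕ) [Group (BlockSpace a)] (z : BlockSpace a × BlockSpace a) :
    BlockSpace a :=
  z.1 * z.2

variable [IsHomogeneousLaw a d]

instance : IsTopologicalGroup (BlockSpace a) where
  continuous_mul := contDiff_mul.continuous
  continuous_inv := contDiff_inv.continuous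

include d

theorem blockDilation_one {r : ℝ} (hr : 0 < r) : blockDilation d r (1 : BlockSpace a) = 1 := by
  have hone := dilation_mul r hr (1 : BlockSpace a) 1
  rw [mul_one] at hone
  exact left_eq_mul.mp hone

theorem blockDilation_inv {r : ℝ} (hr : 0 < r) (x : BlockSpace a) :
    blockDilation d r x⁻¹ = (blockDilation d r x)⁻¹ := by
  rw [eq_inv_iff_mul_eq_one, ← dilation_mul r hr, inv_mul_cancel, blockDilation_one hr]

theorem one_eq_zero : (1 : BlockSpace a) = 0 :=
  (eq_of_tendsto_nhdsGT_of_forall_eq (tendsto_blockDilation (pos a) 1)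
    fun _ hr => blockDilation_one hr).symm

theorem differentiable_mulPair : Differentiable ℝ (mulPair a) :=
  contDiff_mul.differentiable (by simp)

theorem continuous_fderiv_mulPair : Continuous (fderiv ℝ (mulPair a)) :=
  contDiff_mul.continuous_fderiv (by simp)

theorem fderiv_mulPair_blockDilation {r : ℝ} (hr : 0 < r) (z v : BlockSpace a × BlockSpace a) :
    fderiv ℝ (mulPair a) (blockDilation d r z.1, blockDilation d r z.2)
        (blockDilation d r v.1, blockDilation d r v.2) =
      blockDilation d r (fderiv ℝ (mulPair a) z v) :=
  fderiv_apply_of_semiconj (M := blockDilationCLM a d r)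
    (L := (blockDilationCLM a d r).prodMap (blockDilationCLM a d r)) differentiable_mulPair
    (fun z => (dilation_mul r hr z.1 z.2).symm) z v

theorem fderiv_mulPair_zero : fderiv ℝ (mulPair a) 0 =
    ContinuousLinearMap.fst ℝ (BlockSpace a) (BlockSpace a) +
      ContinuousLinearMap.snd ℝ (BlockSpace a) (BlockSpace a) := by
  have comp_eq_id : ∀ i : BlockSpace a →L[ℝ] BlockSpace a × BlockSpace a,
      mulPair a ∘ i = id → (fderiv ℝ (mulPair a) 0).comp i = .id ℝ (BlockSpace a) := by
    intro i hi
    have hcomp := HasFDerivAt.comp (f := i) (0 : BlockSpace a)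
      (differentiable_mulPair (i 0)).hasFDerivAt i.hasFDerivAt
    rw [hi, map_zero] at hcomp
    exact hcomp.unique (hasFDerivAt_id 0)
  apply ContinuousLinearMap.prod_ext
  · rw [comp_eq_id (.inl ℝ _ _) (funext fun x => by simp [mulPair, ← one_eq_zero])]
    ext : 1
    simp
  · rw [comp_eq_id (.inr ℝ _ _) (funext fun x => by simp [mulPair, ← one_eq_zero])]
    ext : 1
    simp

/- Rescaling by `δ_r` and dividing by `r ^ d k` turns the derivative at `z` into the derivative
at `δ_r z` in a direction which still has no component in the first blocks; let `r → 0`. -/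
theorem fderiv_mulPair_apply_eq_zero {k : Fin n} (z : BlockSpace a × BlockSpace a)
    {v w : BlockSpace a} (hv : ∀ i ≤ k, v i = 0) (hw : ∀ i ≤ k, w i = 0) :
    fderiv ℝ (mulPair a) z (v, w) k = 0 := by
  obtain ⟨v', hv'_cont, hv'_zero, hv'⟩ :=
    exists_continuous_blockDilation_eq_pow_smul (mono a) hv
  obtain ⟨w', hw'_cont, hw'_zero, hw'⟩ :=
    exists_continuous_blockDilation_eq_pow_smul (mono a) hw
  let D : ℝ → EuclideanSpace ℝ (Fin (a k)) := fun r =>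
    fderiv ℝ (mulPair a) (blockDilation d r z.1, blockDilation d r z.2) (v' r, w' r) k
  have hD : ∀ r, 0 < r → D r = fderiv ℝ (mulPair a) z (v, w) k := by
    intro r hr
    have hk := congrFun (fderiv_mulPair_blockDilation hr z (v, w)) k
    rw [hv', hw', ← Prod.smul_mk, map_smul] at hk
    exact smul_right_injective _ (pow_pos hr (d k)).ne' hk
  have hD_cont : Continuous D :=
    (continuous_apply k).comp <| (continuous_fderiv_mulPair.comp
      ((continuous_blockDilation z.1).prodMk (continuous_blockDilation z.2))).clm_apply
        (hv'_cont.prodMk hw'_cont)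
  have hD_zero : D 0 = 0 := by
    simp only [D, blockDilation_zero (pos a), ← Prod.zero_eq_mk, fderiv_mulPair_zero]
    simp [hv'_zero, hw'_zero]
  rw [← hD_zero]
  exact (eq_of_tendsto_nhdsGT_of_forall_eq
    ((hD_cont.tendsto 0).mono_left nhdsWithin_le_nhds) hD).symm

theorem mul_apply_congr {k : Fin n} {x y x' y' : BlockSpace a} (hx : ∀ i ≤ k, x i = x' i)
    (hy : ∀ i ≤ k, y i = y' i) : (x * y) k = (x' * y') k := by
  let γ : ℝ → BlockSpace a × BlockSpace a := AffineMap.lineMap (x, y) (x', y')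
  have hγ : ∀ t, HasDerivAt (fun t => mulPair a (γ t) k) 0 t := by
    intro t
    have hk := hasDerivAt_pi.mp
      ((differentiable_mulPair (γ t)).hasFDerivAt.comp_hasDerivAt t AffineMap.hasDerivAt_lineMap) k
    rwa [Prod.mk_sub_mk, fderiv_mulPair_apply_eq_zero _ (fun i hi => by simp [hx i hi])
      (fun i hi => by simp [hy i hi])] at hk
  simpa [γ, mulPair] using
    is_const_of_deriv_eq_zero (fun t => (hγ t).differentiableAt) (fun t => (hγ t).deriv) 0 1

theorem inv_apply_congr {k : Fin n} {x x' : BlockSpace a} (hx : ∀ i ≤ k, x i = x' i) :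
    x⁻¹ k = x'⁻¹ k := by
  have hmul : ∀ i ≤ k, (x' * x'⁻¹) i = (x * x'⁻¹) i := fun i hi =>
    mul_apply_congr (fun j hj => (hx j (hj.trans hi)).symm) fun _ _ => rfl
  simpa using mul_apply_congr (x := x⁻¹) (fun _ _ => rfl) hmul

theorem measurePreserving_mul_left (x : BlockSpace a) :
    MeasurePreserving (fun y : BlockSpace a => x * y) volume volume := by
  have hderiv : ∀ y, HasFDerivAt (fun y : BlockSpace a => x * y)
      ((fderiv ℝ (mulPair a) (x, y)).comp (.inr ℝ _ _)) y := fun y =>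
    (differentiable_mulPair (x, y)).hasFDerivAt.comp y (hasFDerivAt_prodMk_right x y)
  refine measurePreserving_of_abs_det_fderiv_eq_one volume (Group.mulLeft_bijective x)
    (fun y => (hderiv y).differentiableAt) fun y => ?_
  have hdet : ((fderiv ℝ (mulPair a) (x, y)).comp (.inr ℝ _ _)).det =
      ((fderiv ℝ (mulPair a) 0).comp (.inr ℝ _ _)).det :=
    det_eq_of_conj_blockDilation (d := d)
      (A := fun z => (fderiv ℝ (mulPair a) z).comp (.inr ℝ _ _))
      (continuous_fderiv_mulPair.clm_comp continuous_const)
      ((tendsto_blockDilation (pos a) x).prodMk_nhds (tendsto_blockDilation (pos a) y))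
      fun r hr v => by
        simpa [← coe_blockDilationCLM] using fderiv_mulPair_blockDilation hr (x, y) (0, v)
  have hid : (fderiv ℝ (mulPair a) 0).comp (.inr ℝ _ _) = .id ℝ (BlockSpace a) := by
    ext1 v
    simp [fderiv_mulPair_zero]
  rw [(hderiv y).fderiv, hdet, hid]
  simp [ContinuousLinearMap.det]

theorem measurePreserving_inv :
    MeasurePreserving (fun y : BlockSpace a => y⁻¹) volume volume := by
  have hdiff : Differentiable ℝ fun y : BlockSpace a => y⁻¹ :=
    contDiff_inv.differentiable (by simp)
  refine measurePreserving_of_abs_det_fderiv_eq_one volume inv_involutive.bijective hdiff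
    fun y => ?_
  have hdet : (fderiv ℝ (fun y : BlockSpace a => y⁻¹) y).det =
      (fderiv ℝ (fun y : BlockSpace a => y⁻¹) 0).det :=
    det_eq_of_conj_blockDilation (d := d) (contDiff_inv.continuous_fderiv (by simp))
      (tendsto_blockDilation (pos a) y) fun r hr v =>
        fderiv_apply_of_semiconj (L := blockDilationCLM a d r) (M := blockDilationCLM a d r) hdiff
          (fun y => (blockDilation_inv hr y).symm) y v
  have hzero : (0 : BlockSpace a)⁻¹ = 0 := by rw [← one_eq_zero, inv_one]
  have hcomp : (fderiv ℝ (fun y : BlockSpace a => y⁻¹) 0).comp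
      (fderiv ℝ (fun y : BlockSpace a => y⁻¹) 0) = .id ℝ (BlockSpace a) := by
    have hinvol := (hdiff (0 : BlockSpace a)⁻¹).hasFDerivAt.comp 0 (hdiff 0).hasFDerivAt
    rw [inv_involutive.comp_self, hzero] at hinvol
    exact hinvol.unique (hasFDerivAt_id 0)
  have hsq : (fderiv ℝ (fun y : BlockSpace a => y⁻¹) 0).det *
      (fderiv ℝ (fun y : BlockSpace a => y⁻¹) 0).det = 1 := by
    simpa [ContinuousLinearMap.det, LinearMap.det_comp] using
      congrArg ContinuousLinearMap.det hcomp
  rw [hdet]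
  rcases mul_self_eq_one_iff.mp hsq with h | h <;> simp [h]

instance : (volume : Measure (BlockSpace a)).IsMulLeftInvariant :=
  ⟨fun x => (measurePreserving_mul_left x).map_eq⟩

instance : (volume : Measure (BlockSpace a)).IsInvInvariant :=
  ⟨measurePreserving_inv.map_eq⟩

instance : (volume : Measure (BlockSpace a)).IsMulRightInvariant :=
  volume.inv_eq_self (G := BlockSpace a) ▸ inferInstance

end IsHomogeneousLaw

end HomogeneousLaw

section Rectangles

variable {n : ℕ} {a d : Fin n → ℕ} {s t s' t' : Fin n → ℝ}

theorem blockRectangle_mono (hs : 0 ≤ s) (hst : s ≤ t) :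
    blockRectangle a d s ⊆ blockRectangle a d t := fun _ hx k =>
  (hx k).trans (pow_le_pow_left₀ (hs k) (hst k) _)

theorem blockRectangle_eq_pi (s : Fin n → ℝ) : blockRectangle a d s =
    Set.pi Set.univ fun k => Metric.closedBall (0 : EuclideanSpace ℝ (Fin (a k))) (s k ^ d k) := by
  ext x
  simp [blockRectangle]

theorem measurableSet_blockRectangle (s : Fin n → ℝ) : MeasurableSet (blockRectangle a d s) := by
  rw [blockRectangle_eq_pi]
  exact MeasurableSet.univ_pi fun k => measurableSet_closedBall

theorem volume_blockRectangle (hs : 0 ≤ s) : volume (blockRectangle a d s) =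
    ENNReal.ofReal (∏ k, s k ^ (d k * a k)) * volume (blockRectangle a d 1) := by
  rw [blockRectangle_eq_pi, blockRectangle_eq_pi, volume_pi_pi, volume_pi_pi,
    ENNReal.ofReal_prod_of_nonneg fun k _ => pow_nonneg (hs k) _, ← Finset.prod_mul_distrib]
  refine Finset.prod_congr rfl fun k _ => ?_
  rw [Measure.addHaar_closedBall' volume _ (pow_nonneg (hs k) _), Pi.one_apply, one_pow,
    finrank_euclideanSpace, Fintype.card_fin, pow_mul]

theorem volume_blockRectangle_ne_zero (hs : ∀ k, 0 < s k) :
    volume (blockRectangle a d s) ≠ 0 := by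
  rw [blockRectangle_eq_pi, volume_pi_pi]
  exact Finset.prod_ne_zero_iff.mpr fun k _ =>
    (Metric.measure_closedBall_pos volume _ (pow_pos (hs k) _)).ne'

theorem volume_blockRectangle_ne_top (s : Fin n → ℝ) : volume (blockRectangle a d s) ≠ ∞ := by
  rw [blockRectangle_eq_pi, volume_pi_pi]
  exact ENNReal.prod_ne_top fun k _ => measure_closedBall_lt_top.ne

theorem volume_blockRectangle_mul_volume_blockRectangle (hs : 0 ≤ s) (ht : 0 ≤ t) (hs' : 0 ≤ s')
    (ht' : 0 ≤ t') (h : s * t = s' * t') :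
    volume (blockRectangle a d s) * volume (blockRectangle a d t) =
      volume (blockRectangle a d s') * volume (blockRectangle a d t') := by
  have hprod : (∏ k, s k ^ (d k * a k)) * ∏ k, t k ^ (d k * a k) =
      (∏ k, s' k ^ (d k * a k)) * ∏ k, t' k ^ (d k * a k) := by
    simp_rw [← Finset.prod_mul_distrib, ← mul_pow]
    exact Finset.prod_congr rfl fun k _ => congrArg (· ^ _) (congrFun h k)
  rw [volume_blockRectangle hs, volume_blockRectangle ht, volume_blockRectangle hs',
    volume_blockRectangle ht', mul_mul_mul_comm,
    mul_mul_mul_comm (ENNReal.ofReal (∏ k, s' k ^ (d k * a k))),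
    ← ENNReal.ofReal_mul (Finset.prod_nonneg fun k _ => pow_nonneg (hs k) (d k * a k)),
    ← ENNReal.ofReal_mul (Finset.prod_nonneg fun k _ => pow_nonneg (hs' k) (d k * a k)), hprod]

/-- The homogeneous dimension of `BlockSpace a` with respect to the dilations with exponents `d`:
dilating a set by `r` multiplies its volume by `r ^ homogeneousDim a d`. -/
def homogeneousDim (a d : Fin n → ℕ) : ℕ :=
  ∑ k, d k * a k

theorem volume_blockRectangle_smul {r : ℝ} (hr : 0 ≤ r) (hs : 0 ≤ s) :
    volume (blockRectangle a d (r • s)) =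
      ENNReal.ofReal r ^ homogeneousDim a d * volume (blockRectangle a d s) := by
  rw [volume_blockRectangle (smul_nonneg hr hs), volume_blockRectangle hs, ← mul_assoc,
    ← ENNReal.ofReal_pow hr, ← ENNReal.ofReal_mul (by positivity)]
  simp only [Pi.smul_apply, smul_eq_mul, mul_pow, Finset.prod_mul_distrib,
    Finset.prod_pow_eq_pow_sum, homogeneousDim]

theorem exists_norm_le_one_eq_blockDilation (hs : IsAcceptable s) {x : BlockSpace a}
    (hx : x ∈ blockRectangle a d s) (k : Fin n) :
    ∃ y : BlockSpace a, ‖y‖ ≤ 1 ∧ ∀ i ≤ k, x i = blockDilation d (s k) y i := by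
  refine ⟨blockDilation d (s k)⁻¹ fun i => if i ≤ k then x i else 0, ?_, fun i hi => ?_⟩
  · refine (pi_norm_le_iff_of_nonneg zero_le_one).mpr fun i => ?_
    by_cases hi : i ≤ k
    · simp only [blockDilation, hi, if_true, norm_smul, norm_pow, norm_inv]
      rw [Real.norm_of_nonneg (hs.1 k).le, inv_pow, inv_mul_le_one₀ (pow_pos (hs.1 k) _)]
      exact (hx i).trans (pow_le_pow_left₀ (hs.1 i).le (hs.2 hi) _)
    · simp [blockDilation, hi]
  · rw [blockDilation_inv_cancel (hs.1 k).ne']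
    simp [hi]

theorem exists_forall_norm_apply_le_mul_pow {F : BlockSpace a → BlockSpace a → BlockSpace a}
    (hF : Continuous fun z : BlockSpace a × BlockSpace a => F z.1 z.2)
    (hF_dilation : ∀ r : ℝ, 0 < r → ∀ x y,
      blockDilation d r (F x y) = F (blockDilation d r x) (blockDilation d r y))
    (hF_congr : ∀ (k : Fin n) (x y x' y' : BlockSpace a), (∀ i ≤ k, x i = x' i) →
      (∀ i ≤ k, y i = y' i) → F x y k = F x' y' k) :
    ∃ C : ℝ, ∀ s : Fin n → ℝ, IsAcceptable s → ∀ x ∈ blockRectangle a d s,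
      ∀ y ∈ blockRectangle a d s, ∀ k, ‖F x y k‖ ≤ s k ^ d k * C := by
  have hball : IsCompact (Metric.closedBall (0 : BlockSpace a) 1) := isCompact_closedBall 0 1
  obtain ⟨C, hC⟩ := (hball.prod hball).exists_bound_of_continuousOn hF.continuousOn
  refine ⟨C, fun s hs x hx y hy k => ?_⟩
  obtain ⟨x', hx'_norm, hx'⟩ := exists_norm_le_one_eq_blockDilation hs hx k
  obtain ⟨y', hy'_norm, hy'⟩ := exists_norm_le_one_eq_blockDilation hs hy k
  rw [hF_congr k _ _ _ _ hx' hy', ← hF_dilation _ (hs.1 k), blockDilation, norm_smul, norm_pow,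
    Real.norm_of_nonneg (hs.1 k).le]
  have hbound := (norm_le_pi_norm (F x' y') k).trans
    (hC (x', y') ⟨mem_closedBall_zero_iff.mpr hx'_norm, mem_closedBall_zero_iff.mpr hy'_norm⟩)
  exact mul_le_mul_of_nonneg_left hbound (pow_nonneg (hs.1 k).le _)

end Rectangles

section DyadicRectangles

variable {n : ℕ} {a d : Fin n → ℕ} {e e' f f' : Fin n → ℤ}

theorem isAcceptable_zpow {ρ : ℝ} (hρ : 1 < ρ) (he : Monotone e) :
    IsAcceptable fun k => ρ ^ e k :=
  ⟨fun _ => by positivity, fun _ _ h => zpow_le_zpow_right₀ hρ.le (he h)⟩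

/-- The rectangle of size `(2 ^ e_1, …, 2 ^ e_n)`. -/
def dyadicRectangle (a d : Fin n → ℕ) (e : Fin n → ℤ) : Set (BlockSpace a) :=
  blockRectangle a d fun k => (2 : ℝ) ^ e k

theorem dyadicRectangle_mono : Monotone (dyadicRectangle a d) := fun _ _ hee' =>
  blockRectangle_mono (fun _ => by positivity) fun k =>
    zpow_le_zpow_right₀ one_le_two (hee' k)

theorem measurableSet_dyadicRectangle (e : Fin n → ℤ) : MeasurableSet (dyadicRectangle a d e) :=
  measurableSet_blockRectangle _

theorem volume_dyadicRectangle_ne_zero (e : Fin n → ℤ) : volume (dyadicRectangle a d e) ≠ 0 :=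
  volume_blockRectangle_ne_zero fun _ => by positivity

theorem volume_dyadicRectangle_ne_top (e : Fin n → ℤ) : volume (dyadicRectangle a d e) ≠ ∞ :=
  volume_blockRectangle_ne_top _

theorem volume_dyadicRectangle_add_natCast (e : Fin n → ℤ) (c : ℕ) :
    volume (dyadicRectangle a d (e + c)) =
      (2 ^ (c * homogeneousDim a d) : ℝ≥0) * volume (dyadicRectangle a d e) := by
  have hsmul : (fun k => (2 : ℝ) ^ (e + c) k) = (2 : ℝ) ^ c • fun k => (2 : ℝ) ^ e k := by
    funext k
    simp [zpow_add₀, mul_comm]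
  rw [dyadicRectangle, hsmul, volume_blockRectangle_smul (by positivity) fun _ => by positivity,
    dyadicRectangle]
  simp [pow_mul, ENNReal.ofReal_pow]

theorem volume_dyadicRectangle_mul_volume_dyadicRectangle (h : e + e' = f + f') :
    volume (dyadicRectangle a d e) * volume (dyadicRectangle a d e') =
      volume (dyadicRectangle a d f) * volume (dyadicRectangle a d f') := by
  refine volume_blockRectangle_mul_volume_blockRectangle (fun _ => by positivity)
    (fun _ => by positivity) (fun _ => by positivity) (fun _ => by positivity) (funext fun k => ?_)
  simp only [Pi.mul_apply, ← zpow_add₀ (two_ne_zero' ℝ), ← Pi.add_apply, h]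

theorem monotone_add_natCast (he : Monotone e) (c : ℕ) : Monotone (e + (c : Fin n → ℤ)) :=
  he.add_const (c : ℤ)

theorem le_add_natCast (e : Fin n → ℤ) (c : ℕ) : e ≤ e + c := fun k => by simp

/-- Dyadic rectangles with monotone exponents are stable under the group operations, up to
increasing all exponents by `c`. -/
structure RectangleBound (a d : Fin n → ℕ) [Group (BlockSpace a)] (c : ℕ) : Prop where
  mul_mem : ∀ ⦃e : Fin n → ℤ⦄, Monotone e → ∀ ⦃x⦄, x ∈ dyadicRectangle a d e →
    ∀ ⦃y⦄, y ∈ dyadicRectangle a d e → x * y ∈ dyadicRectangle a d (e + c)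
  inv_mem : ∀ ⦃e : Fin n → ℤ⦄, Monotone e → ∀ ⦃x⦄, x ∈ dyadicRectangle a d e →
    x⁻¹ ∈ dyadicRectangle a d (e + c)

variable [Group (BlockSpace a)]

theorem IsHomogeneousLaw.exists_rectangleBound [IsHomogeneousLaw a d] :
    ∃ c : ℕ, RectangleBound a d c := by
  obtain ⟨C₁, hC₁⟩ := exists_forall_norm_apply_le_mul_pow (F := fun x y : BlockSpace a => x * y)
    continuous_mul dilation_mul fun _ _ _ _ _ => mul_apply_congr
  obtain ⟨C₂, hC₂⟩ := exists_forall_norm_apply_le_mul_pow (F := fun x _ : BlockSpace a => x⁻¹)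
    continuous_fst.inv (fun _ hr x _ => blockDilation_inv hr x)
    fun _ _ _ _ _ hx _ => inv_apply_congr hx
  obtain ⟨c, hc⟩ := pow_unbounded_of_one_lt (max C₁ C₂) (one_lt_two (α := ℝ))
  have enlarge : ∀ (e : Fin n → ℤ) k, ((2 : ℝ) ^ e k) ^ d k * max C₁ C₂ ≤
      ((2 : ℝ) ^ (e + c) k) ^ d k := by
    intro e k
    have hpow : (2 : ℝ) ^ c ≤ (2 ^ c) ^ d k :=
      le_self_pow₀ (one_le_pow₀ one_le_two) (pos a k).ne'
    rw [Pi.add_apply, Pi.natCast_apply, zpow_add₀ two_ne_zero, zpow_natCast, mul_pow]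
    exact mul_le_mul_of_nonneg_left (hc.le.trans hpow) (by positivity)
  refine ⟨c, ⟨fun e he x hx y hy k => ?_, fun e he x hx k => ?_⟩⟩
  · refine (hC₁ _ (isAcceptable_zpow one_lt_two he) x hx y hy k).trans (le_trans ?_ (enlarge e k))
    exact mul_le_mul_of_nonneg_left (le_max_left _ _) (by positivity)
  · refine (hC₂ _ (isAcceptable_zpow one_lt_two he) x hx x hx k).trans (le_trans ?_ (enlarge e k))
    exact mul_le_mul_of_nonneg_left (le_max_right _ _) (by positivity)

/-- The exponents `(m, …, m, t, …, t)`, the first `k` of which are `m`. -/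
def twoStepExponent (n k : ℕ) (m t : ℤ) : Fin n → ℤ := fun j =>
  if (j : ℕ) < k then m else t

theorem monotone_twoStepExponent (k : ℕ) {m t : ℤ} (h : m ≤ t) :
    Monotone (twoStepExponent n k m t) := by
  intro i j hij
  have hij' : (i : ℕ) ≤ j := hij
  grind [twoStepExponent]

theorem twoStepExponent_add_natCast (k : ℕ) (m t : ℤ) (c : ℕ) :
    twoStepExponent n k m t + c = twoStepExponent n k (m + c) (t + c) := by
  funext j
  simp only [twoStepExponent, Pi.add_apply, Pi.natCast_apply]
  split_ifs <;> rfl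

theorem RectangleBound.engulfing_twoStepExponent {c : ℕ} (hc : RectangleBound a d c) (k : ℕ)
    (m : ℤ) :
    Engulfing volume (2 ^ (3 * c * homogeneousDim a d))
      (fun i : ℕ => dyadicRectangle a d (twoStepExponent n k m (m + i)))
      (fun i => dyadicRectangle a d
        (twoStepExponent n k (m + (3 * c : ℕ)) (m + (3 * c : ℕ) + i))) := by
  have henlarge : ∀ i : ℕ, twoStepExponent n k (m + (3 * c : ℕ)) (m + (3 * c : ℕ) + i) =
      twoStepExponent n k m (m + i) + (3 * c : ℕ) := fun i => by
    rw [twoStepExponent_add_natCast, add_right_comm]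
  refine ⟨fun i => measurableSet_dyadicRectangle _, fun i j hij => dyadicRectangle_mono ?_,
    fun i => volume_dyadicRectangle_ne_zero _, fun i => volume_dyadicRectangle_ne_top _,
    fun i => ?_, fun i => ?_⟩
  · intro l
    grind [twoStepExponent]
  · rw [henlarge, volume_dyadicRectangle_add_natCast]
  · rw [henlarge]
    have he := monotone_twoStepExponent (n := n) k (show m ≤ m + i by omega)
    rintro _ ⟨_, ⟨x, hx, y, hy, rfl⟩, z, hz, rfl⟩
    have hxy := hc.mul_mem (monotone_add_natCast he c) (inv_inv x ▸ hc.inv_mem he hx)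
      (dyadicRectangle_mono (le_add_natCast _ c) hy)
    have hxyz := hc.mul_mem (monotone_add_natCast (monotone_add_natCast he c) c) hxy
      (dyadicRectangle_mono (le_add_natCast _ c) (inv_inv z ▸ hc.inv_mem he hz))
    refine dyadicRectangle_mono (le_of_eq ?_) hxyz
    push_cast
    ring

end DyadicRectangles

section Factorization

variable {n : ℕ} {a d : Fin n → ℕ} {e e' f : Fin n → ℤ} {c k : ℕ} {m t : ℤ}

/-- The monotone exponents that are at least `m` and constant from the `k`-th one on. -/
def truncatedExponents (n k : ℕ) (m : ℤ) : Set (Fin n → ℤ) :=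
  {e | Monotone e ∧ (∀ j, m ≤ e j) ∧ ∃ t, ∀ j : Fin n, e j ≤ t ∧ (k ≤ j → e j = t)}

/-- The point obtained from `x` by keeping its first `k` blocks and setting the others to `0`. -/
def blockHead (k : ℕ) (x : BlockSpace a) : BlockSpace a := fun j =>
  if (j : ℕ) < k then x j else 0

theorem blockHead_mem_dyadicRectangle {w : BlockSpace a} (hw : w ∈ dyadicRectangle a d e)
    (he : ∀ j : Fin n, (j : ℕ) < k → e j ≤ e' j) : blockHead k w ∈ dyadicRectangle a d e' := by
  intro j
  by_cases hj : (j : ℕ) < k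
  · simp only [blockHead, hj, if_true]
    exact (hw j).trans (pow_le_pow_left₀ (by positivity)
      (zpow_le_zpow_right₀ one_le_two (he j hj)) _)
  · simp only [blockHead, hj, if_false, norm_zero]
    positivity

variable [Group (BlockSpace a)]

theorem IsHomogeneousLaw.mul_inv_blockHead_apply [IsHomogeneousLaw a d]
    (w : BlockSpace a) {j : Fin n} (hj : (j : ℕ) < k) : (w * (blockHead k w)⁻¹) j = 0 := by
  have hhead : ∀ i ≤ j, w i = blockHead k w i := fun i hi => by
    simp [blockHead, (show (i : ℕ) ≤ j from hi).trans_lt hj]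
  rw [mul_apply_congr hhead fun _ _ => rfl, mul_inv_cancel, one_eq_zero, Pi.zero_apply]

namespace RectangleBound

variable [IsHomogeneousLaw a d]

theorem mul_inv_blockHead_mem (hc : RectangleBound a d c) (he : Monotone e)
    (hk : ∀ j : Fin n, k ≤ j → e j = t) {w : BlockSpace a} (hw : w ∈ dyadicRectangle a d e)
    (m : ℤ) :
    w * (blockHead k w)⁻¹ ∈ dyadicRectangle a d (twoStepExponent n k m t + (2 * c : ℕ)) := by
  have hhead : blockHead k w ∈ dyadicRectangle a d e :=
    blockHead_mem_dyadicRectangle hw fun _ _ => le_rfl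
  have hmem := hc.mul_mem (monotone_add_natCast he c)
    (dyadicRectangle_mono (le_add_natCast e c) hw) (hc.inv_mem he hhead)
  intro j
  by_cases hj : (j : ℕ) < k
  · rw [IsHomogeneousLaw.mul_inv_blockHead_apply w hj, norm_zero]
    positivity
  · have hexp : (e + c + c) j = (twoStepExponent n k m t + (2 * c : ℕ)) j := by
      simp only [twoStepExponent, Pi.add_apply, Pi.natCast_apply, hj, if_false, hk j (by omega)]
      omega
    exact (hmem j).trans_eq (congrArg (fun z : ℤ => ((2 : ℝ) ^ z) ^ d j) hexp)

theorem volume_dyadicRectangle_le_volume_inter (hc : RectangleBound a d c) (he : Monotone e)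
    (he' : Monotone e') (hf : Monotone f) (hee' : e ≤ e') (hef : e + c ≤ f) {v w : BlockSpace a}
    (hv : v ∈ dyadicRectangle a d e') (hwv : w * v⁻¹ ∈ dyadicRectangle a d f) :
    volume (dyadicRectangle a d e) ≤ volume
      (dyadicRectangle a d (e' + c) ∩ {y | w * y⁻¹ ∈ dyadicRectangle a d (f + c)}) := by
  rw [← measure_preimage_mul_right volume v⁻¹]
  refine measure_mono fun y (hy : y * v⁻¹ ∈ dyadicRectangle a d e) => ⟨?_, ?_⟩
  · simpa using hc.mul_mem he' (dyadicRectangle_mono hee' hy) hv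
  · have hwy : w * y⁻¹ = w * v⁻¹ * (y * v⁻¹)⁻¹ := by group
    rw [Set.mem_ofPred_eq, hwy]
    exact hc.mul_mem hf hwv (dyadicRectangle_mono hef (hc.inv_mem he hy))

/- A point `w` of the rectangle is written as `(w v⁻¹) v` with `v` the head of `w`; moving `v` in
the rectangle of size `(m, …, m, e_κ, …, e_κ)` shows that the convolution of the two averages on
the right is large at `w`. -/
theorem setLAverage_dyadicRectangle_le (hc : RectangleBound a d c) {κ : Fin n} (he : Monotone e)
    (hm : ∀ j, m ≤ e j) (hκt : e κ ≤ t) (ht : ∀ j > κ, e j = t) {g : BlockSpace a → ℝ≥0∞}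
    (hg : Measurable g) (x : BlockSpace a) :
    ⨍⁻ w in dyadicRectangle a d e, g (x * w⁻¹) ∂volume ≤
      (2 ^ (4 * c * homogeneousDim a d) : ℝ≥0) *
        ⨍⁻ y in dyadicRectangle a d (e ⊓ (fun _ => e κ) + c),
          ⨍⁻ z in dyadicRectangle a d (twoStepExponent n (κ + 1) m t + (3 * c : ℕ)),
            g (x * y⁻¹ * z⁻¹) ∂volume ∂volume := by
  have ht' : ∀ j : Fin n, κ + 1 ≤ (j : ℕ) → e j = t := fun j hj => ht j hj
  have hhead : ∀ j : Fin n, (j : ℕ) < κ + 1 → e j ≤ (e ⊓ fun _ => e κ) j := fun j hj =>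
    le_inf le_rfl (he (Fin.le_def.mpr (Nat.le_of_lt_succ hj)))
  have htail : ∀ j : Fin n, κ + 1 ≤ (j : ℕ) → e κ ≤ e j := fun j hj =>
    he (Fin.le_def.mpr (Nat.le_of_succ_le hj))
  have hinf : Monotone (e ⊓ fun _ => e κ) := he.inf monotone_const
  have hsum : e ⊓ (fun _ => e κ) + twoStepExponent n (κ + 1) m t =
      twoStepExponent n (κ + 1) m (e κ) + e := by
    funext j
    have := hhead j
    have := htail j
    have := ht' j
    grind [twoStepExponent, Pi.inf_apply, Pi.add_apply]
  have hvolume : volume (dyadicRectangle a d (e ⊓ (fun _ => e κ) + c)) *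
      volume (dyadicRectangle a d (twoStepExponent n (κ + 1) m t + (3 * c : ℕ))) =
      (2 ^ (4 * c * homogeneousDim a d) : ℝ≥0) *
        (volume (dyadicRectangle a d (twoStepExponent n (κ + 1) m (e κ))) *
          volume (dyadicRectangle a d e)) := by
    rw [volume_dyadicRectangle_add_natCast, volume_dyadicRectangle_add_natCast, mul_mul_mul_comm,
      volume_dyadicRectangle_mul_volume_dyadicRectangle hsum, ← ENNReal.coe_mul, ← pow_add]
    congr 3
    ring
  refine setLAverage_le_mul_setLAverage_setLAverage (measurableSet_dyadicRectangle _)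
    (measurableSet_dyadicRectangle _) (volume_dyadicRectangle_ne_zero _)
    (volume_dyadicRectangle_ne_top _) (volume_dyadicRectangle_ne_zero _)
    (volume_dyadicRectangle_ne_top _) hvolume.le (fun w hw => ?_) hg x
  have hcast : twoStepExponent n (κ + 1) m t + ((3 * c : ℕ) : Fin n → ℤ) =
      twoStepExponent n (κ + 1) m t + (2 * c : ℕ) + c := by
    push_cast
    ring
  rw [hcast]
  refine hc.volume_dyadicRectangle_le_volume_inter (monotone_twoStepExponent _ (hm κ)) hinf
    (monotone_add_natCast (monotone_twoStepExponent _ ((hm κ).trans hκt)) _) (fun j => ?_)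
    (fun j => ?_) (blockHead_mem_dyadicRectangle hw hhead) (hc.mul_inv_blockHead_mem he ht' hw m)
  · have := hm j
    have := hm κ
    have := htail j
    grind [twoStepExponent, Pi.inf_apply]
  · simp only [twoStepExponent, Pi.add_apply, Pi.natCast_apply]
    split_ifs <;> omega

theorem setLAverage_le_maximalAverage_maximalAverage (hc : RectangleBound a d c) {κ : Fin n}
    (he : e ∈ truncatedExponents n (κ + 1) m) {g : BlockSpace a → ℝ≥0∞} (hg : Measurable g)
    (x : BlockSpace a) :
    ⨍⁻ w in dyadicRectangle a d e, g (x * w⁻¹) ∂volume ≤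
      (2 ^ (4 * c * homogeneousDim a d) : ℝ≥0) *
        maximalAverage volume (fun e : truncatedExponents n κ m => dyadicRectangle a d e)
          (maximalAverage volume (fun i : ℕ => dyadicRectangle a d
            (twoStepExponent n (κ + 1) (m + (3 * c : ℕ)) (m + (3 * c : ℕ) + i))) g) x := by
  obtain ⟨hmono, hm, t, ht⟩ := he
  refine (hc.setLAverage_dyadicRectangle_le hmono hm (ht κ).1 (fun j hj => (ht j).2 hj) hg
    x).trans (mul_le_mul_right ?_ _)
  have hmem : e ⊓ (fun _ => e κ) + c ∈ truncatedExponents n κ m := by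
    refine ⟨monotone_add_natCast (hmono.inf monotone_const) c, fun j => ?_, e κ + c, fun j => ?_⟩
    · exact (le_inf (hm j) (hm κ)).trans (le_add_natCast _ c j)
    · exact ⟨add_le_add_left inf_le_right _, fun hj =>
        congrArg (· + (c : ℤ)) (inf_eq_right.mpr (hmono (Fin.le_def.mpr hj)))⟩
  have hstep : twoStepExponent n (κ + 1) m t + (3 * c : ℕ) = twoStepExponent n (κ + 1)
      (m + (3 * c : ℕ)) (m + (3 * c : ℕ) + ((t - m).toNat : ℕ)) := by
    have := (hm κ).trans (ht κ).1
    rw [twoStepExponent_add_natCast]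
    congr 1
    omega
  refine le_trans (lintegral_mono fun y => ?_)
    (setLAverage_le_maximalAverage (fun e : truncatedExponents n κ m => dyadicRectangle a d e) _ x
      ⟨_, hmem⟩)
  rw [hstep]
  exact setLAverage_le_maximalAverage (fun i : ℕ => dyadicRectangle a d _) g (x * y⁻¹) _

end RectangleBound

end Factorization

section DyadicMaximalOperator

variable {n : ℕ} {a d : Fin n → ℕ}

theorem maximalAverage_le_maximalAverage_of_forall_exists {G : Type*} [Group G] [MeasurableSpace G]
    {μ : Measure G} {ι κ : Type*} {B : ι → Set G} {B' : κ → Set G} (h : ∀ i, ∃ j, B i = B' j)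
    (f : G → ℝ≥0∞) (x : G) : maximalAverage μ B f x ≤ maximalAverage μ B' f x := by
  refine iSup_le fun i => ?_
  obtain ⟨j, hj⟩ := h i
  exact hj ▸ setLAverage_le_maximalAverage B' f x j

theorem exists_eq_twoStepExponent_zero {m : ℤ} {e : Fin n → ℤ}
    (he : e ∈ truncatedExponents n 0 m) : ∃ i : ℕ, e = twoStepExponent n 0 m (m + i) := by
  obtain ⟨-, hm, t, ht⟩ := he
  refine ⟨(t - m).toNat, funext fun j => ?_⟩
  have := hm j
  have := (ht j).2 j.1.zero_le
  grind [twoStepExponent]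

theorem truncatedExponents_anti {k : ℕ} : Antitone (truncatedExponents n k) :=
  fun _ _ hm _ he => ⟨he.1, fun j => hm.trans (he.2.1 j), he.2.2⟩

theorem exists_mem_truncatedExponents {e : Fin n → ℤ} (he : Monotone e) :
    ∃ L : ℕ, e ∈ truncatedExponents n n (-L) := by
  have hle : ∀ j, (e j).natAbs ≤ ∑ i, (e i).natAbs := fun j =>
    Finset.single_le_sum (f := fun i => (e i).natAbs) (fun _ _ => Nat.zero_le _) (Finset.mem_univ j)
  refine ⟨∑ i, (e i).natAbs, he, fun j => ?_, (∑ i, (e i).natAbs : ℕ), fun j => ⟨?_, ?_⟩⟩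
  · have := hle j
    omega
  · have := hle j
    omega
  · exact fun hj => absurd j.2 hj.not_gt

variable [Group (BlockSpace a)] [IsHomogeneousLaw a d] {p : ℝ}

theorem exists_squareFunctionBound_truncatedExponents (hp : 1 < p)
    {k : ℕ} (hk : k ≤ n) :
    ∃ C : ℝ≥0, ∀ m : ℤ, SquareFunctionBound volume p C (maximalAverage volume
      fun e : truncatedExponents n k m => dyadicRectangle a d e) := by
  have hp0 : 0 ≤ p := by positivity
  obtain ⟨c, hc⟩ := IsHomogeneousLaw.exists_rectangleBound (a := a)
  obtain ⟨C₀, hC₀⟩ := Engulfing.exists_squareFunctionBound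
    (μ := (volume : Measure (BlockSpace a))) hp (2 ^ (3 * c * homogeneousDim a d))
  have hstep : ∀ k m, SquareFunctionBound volume p C₀ (maximalAverage volume
      fun i : ℕ => dyadicRectangle a d (twoStepExponent n k m (m + i))) := fun k m =>
    hC₀ _ _ _ (hc.engulfing_twoStepExponent k m) (hc.engulfing_twoStepExponent k _)
  induction k with
  | zero =>
    refine ⟨_, fun m => (hstep 0 m).of_le_mul (A := 1) hp0 fun f _ x => ?_⟩
    rw [ENNReal.coe_one, one_mul]
    refine maximalAverage_le_maximalAverage_of_forall_exists (fun e => ?_) f x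
    exact (exists_eq_twoStepExponent_zero e.2).imp fun _ => congrArg (dyadicRectangle a d)
  | succ k ih =>
    obtain ⟨C, hC⟩ := ih (Nat.le_of_succ_le hk)
    exact ⟨_, fun m => ((hC m).comp (hstep (k + 1) _)
      fun _ => measurable_maximalAverage _).of_le_mul hp0 fun f hf x => iSup_le fun e =>
        hc.setLAverage_le_maximalAverage_maximalAverage (κ := ⟨k, hk⟩) e.2 hf x⟩

theorem exists_squareFunctionBound_dyadicRectangle (hp : 1 < p) :
    ∃ C : ℝ≥0, SquareFunctionBound volume p C (maximalAverage volume
      fun e : {e : Fin n → ℤ // Monotone e} => dyadicRectangle a d e) := by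
  obtain ⟨C, hC⟩ := exists_squareFunctionBound_truncatedExponents (a := a) (d := d) hp le_rfl
  have hmono : Monotone fun L : ℕ => maximalAverage volume
      fun e : truncatedExponents n n (-L) => dyadicRectangle a d e := fun L L' hL =>
    maximalAverage_le_maximalAverage_of_forall_exists fun e =>
      ⟨⟨e, truncatedExponents_anti (by omega) e.2⟩, rfl⟩
  have hiSup := SquareFunctionBound.iSup (by positivity) hmono
    (fun _ _ => measurable_maximalAverage _) fun L => hC (-L)
  refine ⟨_, hiSup.of_le_mul (A := 1) (by positivity) fun f _ x => iSup_le fun e => ?_⟩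
  obtain ⟨L, hL⟩ := exists_mem_truncatedExponents e.2
  rw [ENNReal.coe_one, one_mul]
  exact le_iSup_of_le L <| setLAverage_le_maximalAverage
    (fun e : truncatedExponents n n (-L) => dyadicRectangle a d e) f x ⟨e, hL⟩

end DyadicMaximalOperator

section RectangleMaximalOperator

open Filter Topology

variable {n : ℕ} {a d : Fin n → ℕ}

theorem exists_monotone_le_zpow_le_smul {s : Fin n → ℝ} (hs : IsAcceptable s) {ρ : ℝ}
    (hρ : 1 < ρ) :
    ∃ e : Fin n → ℤ, Monotone e ∧ (s ≤ fun k => ρ ^ e k) ∧ (fun k => ρ ^ e k) ≤ ρ • s := by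
  have hρ0 : 0 < ρ := zero_lt_one.trans hρ
  choose e he using fun k => exists_mem_Ioc_zpow (hs.1 k) hρ
  refine ⟨e + 1, fun i j hij => ?_, fun k => (he k).2, fun k => ?_⟩
  · have hlt : ρ ^ e i < ρ ^ (e j + 1) := ((he i).1.trans_le (hs.2 hij)).trans_le (he j).2
    exact Int.add_le_add_right (Int.lt_add_one_iff.mp ((zpow_lt_zpow_iff_right₀ hρ).mp hlt)) 1
  · simp only [Pi.add_apply, Pi.one_apply, Pi.smul_apply, smul_eq_mul, zpow_add_one₀ hρ0.ne',
      mul_comm _ ρ]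
    exact mul_le_mul_of_nonneg_left (he k).1.le hρ0.le

variable [Group (BlockSpace a)]

/-- The maximal operator of the rectangles of acceptable size, acting on functions with values in
`[0, ∞]`. The maximal function of `f` is its value at `‖f‖ₑ`. -/
noncomputable def rectangleMaximal (d : Fin n → ℕ) :
    (BlockSpace a → ℝ≥0∞) → BlockSpace a → ℝ≥0∞ :=
  maximalAverage volume fun s : {s : Fin n → ℝ // IsAcceptable s} => blockRectangle a d s

/-- The maximal operator of the rectangles whose sizes are acceptable and made of powers of `ρ`.
Its family of rectangles is countable. -/
noncomputable def gridMaximal (d : Fin n → ℕ) (ρ : ℝ) :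
    (BlockSpace a → ℝ≥0∞) → BlockSpace a → ℝ≥0∞ :=
  maximalAverage volume fun e : {e : Fin n → ℤ // Monotone e} =>
    blockRectangle a d fun k => ρ ^ e.1 k

variable {ρ : ℝ}

theorem gridMaximal_le_rectangleMaximal (hρ : 1 < ρ) (f : BlockSpace a → ℝ≥0∞)
    (x : BlockSpace a) : gridMaximal d ρ f x ≤ rectangleMaximal d f x :=
  iSup_le fun e => setLAverage_le_maximalAverage
    (fun s : {s : Fin n → ℝ // IsAcceptable s} => blockRectangle a d s) f x
    ⟨_, isAcceptable_zpow hρ e.2⟩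

theorem rectangleMaximal_le_mul_gridMaximal (hρ : 1 < ρ) (f : BlockSpace a → ℝ≥0∞)
    (x : BlockSpace a) :
    rectangleMaximal d f x ≤ ENNReal.ofReal ρ ^ homogeneousDim a d * gridMaximal d ρ f x := by
  refine iSup_le fun ⟨s, hs⟩ => ?_
  obtain ⟨e, he, hse, hes⟩ := exists_monotone_le_zpow_le_smul hs hρ
  have hs0 : 0 ≤ s := fun k => (hs.1 k).le
  have hvolume : volume (blockRectangle a d fun k => ρ ^ e k) ≤
      ENNReal.ofReal ρ ^ homogeneousDim a d * volume (blockRectangle a d s) := by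
    rw [← volume_blockRectangle_smul (by positivity) hs0]
    exact measure_mono (blockRectangle_mono (hs0.trans hse) hes)
  refine (setLAverage_le_mul_setLAverage (blockRectangle_mono hs0 hse)
    (volume_blockRectangle_ne_zero hs.1) (volume_blockRectangle_ne_top _) hvolume _).trans ?_
  exact mul_le_mul_right (setLAverage_le_maximalAverage
    (fun e : {e : Fin n → ℤ // Monotone e} => blockRectangle a d fun k => ρ ^ e.1 k) f x
    ⟨e, he⟩) _

theorem rectangleMaximal_eq_iInf_gridMaximal (f : BlockSpace a → ℝ≥0∞) (x : BlockSpace a) :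
    rectangleMaximal d f x = ⨅ m : ℕ, ENNReal.ofReal (1 + 1 / ((m : ℝ) + 1)) ^ homogeneousDim a d *
      gridMaximal d (1 + 1 / ((m : ℝ) + 1)) f x := by
  have hρ : ∀ m : ℕ, 1 < 1 + 1 / ((m : ℝ) + 1) := fun m => lt_add_of_pos_right 1 (by positivity)
  refine le_antisymm (le_iInf fun m => rectangleMaximal_le_mul_gridMaximal (hρ m) f x) ?_
  have hone : Tendsto (fun m : ℕ => ENNReal.ofReal (1 + 1 / ((m : ℝ) + 1)) ^ homogeneousDim a d)
      atTop (𝓝 1) := by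
    simpa using ENNReal.Tendsto.pow (n := homogeneousDim a d) (ENNReal.tendsto_ofReal
      (tendsto_one_div_add_atTop_nhds_zero_nat.const_add (1 : ℝ)))
  have htendsto := ENNReal.Tendsto.mul_const (b := rectangleMaximal d f x) hone
    (.inl one_ne_zero)
  rw [one_mul] at htendsto
  exact ge_of_tendsto' htendsto fun m => (iInf_le _ m).trans
    (mul_le_mul_right (gridMaximal_le_rectangleMaximal (hρ m) f x) _)

theorem maximalAverage_congr_ae {G : Type*} [Group G] [MeasurableSpace G] [MeasurableMul₂ G]
    [MeasurableInv G] {μ : Measure G} [μ.IsMulLeftInvariant] [μ.IsInvInvariant] {ι : Type*}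
    {B : ι → Set G} {f g : G → ℝ≥0∞} (h : f =ᵐ[μ] g) :
    maximalAverage μ B f = maximalAverage μ B g := by
  funext x
  refine iSup_congr fun i => laverage_congr (ae_restrict_of_ae ?_)
  simpa only [div_eq_mul_inv, Function.comp_def, Filter.EventuallyEq] using
    (Measure.measurePreserving_div_left μ x).quasiMeasurePreserving.ae_eq_comp h

variable [IsHomogeneousLaw a d]

theorem measurable_rectangleMaximal {f : BlockSpace a → ℝ≥0∞} (hf : AEMeasurable f) :
    Measurable (rectangleMaximal d f) := by
  rw [rectangleMaximal, maximalAverage_congr_ae hf.ae_eq_mk, ← rectangleMaximal,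
    funext (rectangleMaximal_eq_iInf_gridMaximal _)]
  exact .iInf fun m => (measurable_maximalAverage _ hf.measurable_mk).const_mul _

theorem exists_squareFunctionBound_rectangleMaximal {p : ℝ} (hp : 1 < p) :
    ∃ C : ℝ≥0, SquareFunctionBound (α := BlockSpace a) volume p C (rectangleMaximal d) := by
  obtain ⟨C, hC⟩ := exists_squareFunctionBound_dyadicRectangle (a := a) (d := d) hp
  refine ⟨_, hC.of_le_mul (A := 2 ^ homogeneousDim a d) (by positivity) fun f _ x => ?_⟩
  simpa [gridMaximal, dyadicRectangle] using rectangleMaximal_le_mul_gridMaximal one_lt_two f x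

end RectangleMaximalOperator

section LpBounds

variable {α : Type*} [MeasurableSpace α] {μ : Measure α} {T : (α → ℝ≥0∞) → α → ℝ≥0∞} {C : ℝ≥0}

theorem SquareFunctionBound.strongTypeBound {p : ℝ} (h : SquareFunctionBound μ p C T)
    (hT : T 0 = 0) : StrongTypeBound μ p C T := by
  intro f hf
  set F : ℕ → α → ℝ≥0∞ := Pi.single 0 f
  have hsum : ∀ S : (α → ℝ≥0∞) → α → ℝ≥0∞, S 0 = 0 → ∀ x,
      (∑' j, S (F j) x ^ 2) ^ (p / 2) = S f x ^ p := fun S hS x => by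
    have hF : ∀ j ≠ 0, S (F j) x ^ 2 = 0 := fun j hj => by
      simp [F, Pi.single_eq_of_ne hj, hS]
    rw [tsum_eq_single 0 hF, ← ENNReal.rpow_natCast_mul, Nat.cast_ofNat,
      mul_div_cancel₀ _ two_ne_zero]
    simp [F]
  have hmeas : ∀ j, Measurable (F j) := fun j => by
    rcases eq_or_ne j 0 with rfl | hj
    · simpa [F] using hf
    · simpa [F, Pi.single_eq_of_ne hj] using measurable_zero
  have hsum_id : ∀ x, (∑' j, F j x ^ 2) ^ (p / 2) = f x ^ p := hsum id rfl
  simpa only [hsum T hT, hsum_id] using h F hmeas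

variable {p : ℝ≥0∞}

theorem eLpNorm_le_of_lintegral_rpow_le (hp : p ≠ 0) (hp_top : p ≠ ∞) {F f : α → ℝ≥0∞}
    (h : ∫⁻ x, F x ^ p.toReal ∂μ ≤ C * ∫⁻ x, f x ^ p.toReal ∂μ) :
    eLpNorm F p μ ≤ (C ^ (1 / p.toReal) : ℝ≥0) * eLpNorm f p μ := by
  have hp_inv : 0 ≤ 1 / p.toReal := by positivity
  rw [eLpNorm_eq_lintegral_rpow_enorm_toReal hp hp_top,
    eLpNorm_eq_lintegral_rpow_enorm_toReal hp hp_top, ENNReal.coe_rpow_of_nonneg _ hp_inv,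
    ← ENNReal.mul_rpow_of_nonneg _ _ hp_inv]
  exact ENNReal.rpow_le_rpow h hp_inv

theorem StrongTypeBound.eLpNorm_le (h : StrongTypeBound μ p.toReal C T) (hp : p ≠ 0)
    (hp_top : p ≠ ∞) (hT : ∀ ⦃f g⦄, f =ᵐ[μ] g → T f = T g) {f : α → ℝ≥0∞}
    (hf : AEMeasurable f μ) :
    eLpNorm (T f) p μ ≤ (C ^ (1 / p.toReal) : ℝ≥0) * eLpNorm f p μ := by
  rw [hT hf.ae_eq_mk, eLpNorm_congr_ae hf.ae_eq_mk]
  exact eLpNorm_le_of_lintegral_rpow_le hp hp_top (h _ hf.measurable_mk)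

theorem SquareFunctionBound.eLpNorm_le (h : SquareFunctionBound μ p.toReal C T) (hp : p ≠ 0)
    (hp_top : p ≠ ∞) (hT : ∀ ⦃f g⦄, f =ᵐ[μ] g → T f = T g) {f : ℕ → α → ℝ≥0∞}
    (hf : ∀ j, AEMeasurable (f j) μ) :
    eLpNorm (fun x => (∑' j, T (f j) x ^ 2) ^ (1 / 2 : ℝ)) p μ ≤
      (C ^ (1 / p.toReal) : ℝ≥0) * eLpNorm (fun x => (∑' j, f j x ^ 2) ^ (1 / 2 : ℝ)) p μ := by
  have hmk : (fun x => (∑' j, f j x ^ 2) ^ (1 / 2 : ℝ)) =ᵐ[μ]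
      fun x => (∑' j, (hf j).mk (f j) x ^ 2) ^ (1 / 2 : ℝ) := by
    filter_upwards [ae_all_iff.mpr fun j => (hf j).ae_eq_mk] with x hx
    simp_rw [← hx]
  simp_rw [fun j => hT (hf j).ae_eq_mk]
  rw [eLpNorm_congr_ae hmk]
  refine eLpNorm_le_of_lintegral_rpow_le hp hp_top ?_
  simp_rw [← ENNReal.rpow_mul, one_div_mul_eq_div]
  exact h _ fun j => (hf j).measurable_mk

end LpBounds

theorem HomogeneousGroup.maximalFunction_eq_rectangleMaximal {n : ℕ} {a d : Fin n → ℕ}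
    (G : HomogeneousGroup a d) {𝕜 : Type*} [RCLike 𝕜] (f : BlockSpace a → 𝕜) :
    letI := G.toGroup
    G.maximalFunction f = rectangleMaximal d fun x => ‖f x‖ₑ := by
  funext x
  simp only [maximalFunction, rectangleMaximal, maximalAverage, iSup_subtype, setLAverage_eq,
    ENNReal.div_eq_inv_mul]

theorem mainTheorem8 {𝕜 : Type*} [RCLike 𝕜] {n : ℕ} (a d : Fin n → ℕ)
    (ha : ∀ k, 0 < a k) (hd : ∀ k, 0 < d k) (hd_mono : Monotone d)
    (G : HomogeneousGroup a d) (p : ℝ≥0∞) (hp_one : 1 < p) (hp_top : p < ⊤) :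
    ((∀ f g : BlockSpace a → 𝕜, f =ᵐ[volume] g →
        G.maximalFunction f = G.maximalFunction g) ∧
      ∃ A : ℝ≥0, ∀ f : BlockSpace a → 𝕜, MemLp f p volume →
        MemLp (G.maximalFunction f) p volume ∧
        eLpNorm (G.maximalFunction f) p volume ≤ A * eLpNorm f p volume) ∧
    (∃ A : ℝ≥0, ∀ f : ℕ → BlockSpace a → 𝕜,
      (∀ j, AEStronglyMeasurable (f j) volume) →
        eLpNorm (fun x => (∑' j, G.maximalFunction (f j) x ^ 2) ^ (1 / 2 : ℝ)) p volume ≤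
          A * eLpNorm (fun x => (∑' j, ‖f j x‖ₑ ^ 2) ^ (1 / 2 : ℝ)) p volume) := by
  let := G.toGroup
  have : IsHomogeneousLaw a d := ⟨G.contDiff_mul, G.contDiff_inv, G.dilation_mul, hd, hd_mono⟩
  have hp_zero : p ≠ 0 := (zero_lt_one.trans hp_one).ne'
  have hp : 1 < p.toReal := (ENNReal.toReal_lt_toReal ENNReal.one_ne_top hp_top.ne).mpr hp_one
  obtain ⟨C, hC⟩ := exists_squareFunctionBound_rectangleMaximal (a := a) (d := d) hp
  have hcongr : ∀ ⦃f g : BlockSpace a → ℝ≥0∞⦄, f =ᵐ[volume] g →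
      rectangleMaximal d f = rectangleMaximal d g := fun _ _ => maximalAverage_congr_ae
  have hzero : rectangleMaximal (a := a) d 0 = 0 :=
    funext fun x => nonpos_iff_eq_zero.mp (maximalAverage_le_of_forall_le (fun _ => le_rfl) x)
  simp only [G.maximalFunction_eq_rectangleMaximal]
  refine ⟨⟨fun f g hfg => hcongr (hfg.fun_comp enorm), C ^ (1 / p.toReal), fun f hf => ?_⟩,
    C ^ (1 / p.toReal), fun f hf => hC.eLpNorm_le hp_zero hp_top.ne hcongr fun j => (hf j).enorm⟩
  have hle := (hC.strongTypeBound hzero).eLpNorm_le hp_zero hp_top.ne hcongr hf.1.enorm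
  rw [eLpNorm_enorm] at hle
  exact ⟨⟨(measurable_rectangleMaximal hf.1.enorm).aestronglyMeasurable,
    hle.trans_lt (ENNReal.mul_lt_top ENNReal.coe_lt_top hf.2)⟩, hle⟩
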